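/- Let $\mathbb X\subset\mathbb R^d$ be closed and connected. Let $\Omega_T$ ($T\ge 0$) denote either, for all $T$, the space $C[0,T]$ of continuous paths $[0,T]\to\mathbb X$ with the uniform metric, or, for all $T$, the space $D[0,T]$ of right-continuous paths $[0,T]\to\mathbb X$ with left limits with the Skorokhod metric; put $\Omega=\Omega_1$. Let $X$ be the canonical process, $\mathcal F_s=\sigma(X_r:r\le s)$, and for $0\le s<t\le 1$ and $\omega\in\Omega$ let $X_{[s,t]}(\omega)=(\omega_{s+r})_{0\le r\le t-s}\in\Omega_{t-s}$. Write $\mathfrak P(E)$ for the set of Borel probability measures on $E$ with the weak topology. For all $0\le s<t\le 1$ let a map $\Gamma_{[s,t]}:\mathbb X\to 2^{\mathfrak P(\Omega_{t-s})}$ be given such that for every $x$ the set $\Gamma_{[s,t]}(x)$ is nonempty, every $Q\in\Gamma_{[s,t]}(x)$ is carried by the paths starting at $x$, and the graph $\{(x,Q):x\in\mathbb X,\ Q\in\Gamma_{[s,t]}(x)\}$ is analytic. Let $C_{[s,t]}$ be the set of all $P\in\mathfrak P(\Omega)$ such that, for $P$-almost every $\omega$, the regular conditional law under $P$ of $X_{[s,t]}$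 given $\mathcal F_s$, evaluated at $\omega$, belongs to $\Gamma_{[s,t]}(\omega_s)$. Assume the consistency property $$C_{[s,t]}\cap C_{[s',t']}=C_{[s\wedge s',\,t\vee t']}\quad\text{whenever } [s,t]\cap[s',t']\ne\emptyset .$$ Let $(\alpha_t)_{t\in[0,1]}\subset\mathfrak P(\mathbb X)$ be such that $t\mapsto\alpha_t$ is weakly continuous if $\Omega=C[0,1]$, and weakly right-continuous if $\Omega=D[0,1]$, and put $A_t=\{P\in\mathfrak P(\Omega): P\circ X_t^{-1}=\alpha_t\}$. Assume that for all $0\le s<t\le 1$ the set $\{P\circ X_{[s,t]}^{-1}: P\in A_s\cap C_{[s,t]}\}\subset\mathfrak P(\Omega_{t-s})$ is convex and weakly compact. Then $$\bigcap_{0\le r\le 1}A_r\ \cap\bigcap_{0\le s<t\le 1}C_{[s,t]}\neq\emptyset$$ if and only if $$\int f^{\Gamma_{[s,t]}}\,d\alpha_s\le\int f\,d\alpha_t\quad\text{for all } 0\le s<t\le 1\text{ and all bounded continuous } f:\mathbb X\to\mathbb R,$$ where $f^{\Gamma_{[s,t]}}(x)=\inf_{Q\in\Gamma_{[s,t]}(x)}\mathbb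 E^Q[f(X_{t-s})]$. -/

import Mathlib

open MeasureTheory Set Filter Topology unitInterval
open scoped NNReal ENNReal BoundedContinuousFunction

noncomputable section

namespace ConstrainedPeacock

/-- An `E`-valued path on `[0, T]` that is right continuous with left limits. (At `t = T` right
continuity and at `t = 0` existence of a left limit are empty requirements.) -/
structure RCLLPath (T : ℝ) (E : Type*) [TopologicalSpace E] where
  toFun : Icc (0 : ℝ) T → E
  rightCont : ∀ t, ContinuousWithinAt toFun (Ici t) t
  leftLim : ∀ t, ∃ l, Tendsto toFun (𝓝[<] t) (𝓝 l)

/-- The Skorokhod distance: the infimum over all increasing bijections `τ` of `[0, T]` of the larger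
of `sup |τ t - t|` and `sup dist (x t) (y (τ t))`. -/
def skorokhodEDist {T : ℝ} {E : Type*} [PseudoEMetricSpace E] (x y : RCLLPath T E) : ℝ≥0∞ :=
  ⨅ τ : Icc (0 : ℝ) T ≃o Icc (0 : ℝ) T,
    (⨆ t, edist (τ t) t) ⊔ (⨆ t, edist (x.toFun t) (y.toFun (τ t)))

theorem skorokhodEDist_self {T : ℝ} {E : Type*} [PseudoEMetricSpace E] (x : RCLLPath T E) :
    skorokhodEDist x x = 0 := by
  refine le_antisymm ((iInf_le _ (OrderIso.refl _)).trans ?_) bot_le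
  simp

theorem skorokhodEDist_symm_le {T : ℝ} {E : Type*} [PseudoEMetricSpace E] (x y : RCLLPath T E) :
    skorokhodEDist y x ≤ skorokhodEDist x y := by
  refine le_iInf fun τ => (iInf_le _ τ.symm).trans (sup_le_sup ?_ ?_)
  · refine iSup_le fun t => le_trans (le_of_eq ?_) (le_iSup _ (τ.symm t))
    rw [OrderIso.apply_symm_apply, edist_comm]
  · refine iSup_le fun t => le_trans (le_of_eq ?_) (le_iSup _ (τ.symm t))
    rw [OrderIso.apply_symm_apply, edist_comm]

theorem skorokhodEDist_triangle {T : ℝ} {E : Type*} [PseudoEMetricSpace E]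
    (x y z : RCLLPath T E) :
    skorokhodEDist x z ≤ skorokhodEDist x y + skorokhodEDist y z := by
  simp only [skorokhodEDist, ENNReal.iInf_add, ENNReal.add_iInf]
  refine le_iInf fun ρ => le_iInf fun τ => (iInf_le _ (τ.trans ρ)).trans (sup_le ?_ ?_)
  · refine iSup_le fun t => ?_
    refine (edist_triangle _ (τ t) _).trans ?_
    rw [add_comm]
    exact add_le_add ((le_iSup (fun t => edist (τ t) t) t).trans le_sup_left)
      ((le_iSup (fun t => edist (ρ t) t) (τ t)).trans le_sup_left)
  · refine iSup_le fun t => ?_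
    refine (edist_triangle _ (y.toFun (τ t)) _).trans ?_
    exact add_le_add
      ((le_iSup (fun t => edist (x.toFun t) (y.toFun (τ t))) t).trans le_sup_right)
      ((le_iSup (fun t => edist (y.toFun t) (z.toFun (ρ t))) (τ t)).trans le_sup_right)

/-- `D[0, T]` with the Skorokhod metric. -/
instance {T : ℝ} {E : Type*} [PseudoEMetricSpace E] : PseudoEMetricSpace (RCLLPath T E) where
  edist := skorokhodEDist
  edist_self := skorokhodEDist_self
  edist_comm x y := le_antisymm (skorokhodEDist_symm_le y x) (skorokhodEDist_symm_le x y)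
  edist_triangle := skorokhodEDist_triangle

/-- The two kinds of path spaces. -/
inductive PathKind
  | continuous
  | rcll

/-- The path space over `[0, T]`: `C[0, T]` or `D[0, T]`. -/
def PathSpace (k : PathKind) (T : ℝ) (E : Type*) [TopologicalSpace E] : Type _ :=
  match k with
  | .continuous => C(Icc (0 : ℝ) T, E)
  | .rcll => RCLLPath T E

/-- The topology of uniform convergence on `C[0, T]`, and the Skorokhod topology on `D[0, T]`. -/
instance {k : PathKind} {T : ℝ} {E : Type*} [PseudoEMetricSpace E] :
    TopologicalSpace (PathSpace k T E) :=
  match k with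
  | .continuous => inferInstanceAs (TopologicalSpace C(Icc (0 : ℝ) T, E))
  | .rcll => inferInstanceAs (TopologicalSpace (RCLLPath T E))

instance {k : PathKind} {T : ℝ} {E : Type*} [PseudoEMetricSpace E] :
    MeasurableSpace (PathSpace k T E) := borel _

instance {k : PathKind} {T : ℝ} {E : Type*} [PseudoEMetricSpace E] :
    BorelSpace (PathSpace k T E) := ⟨rfl⟩

/-- The canonical process: the position of a path at a time. -/
def PathSpace.eval {k : PathKind} {T : ℝ} {E : Type*} [TopologicalSpace E]
    (t : Icc (0 : ℝ) T) (ω : PathSpace k T E) : E :=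
  match k, ω with
  | .continuous, ω => ContinuousMap.toFun ω t
  | .rcll, ω => RCLLPath.toFun ω t

/-- The position of a path on `[0, T]` at time `0`. -/
def PathSpace.start {k : PathKind} {T : ℝ} (hT : 0 ≤ T) {E : Type*} [TopologicalSpace E]
    (ω : PathSpace k T E) : E :=
  ω.eval ⟨0, left_mem_Icc.2 hT⟩

/-- The position of a path on `[0, T]` at time `T`. -/
def PathSpace.final {k : PathKind} {T : ℝ} (hT : 0 ≤ T) {E : Type*} [TopologicalSpace E]
    (ω : PathSpace k T E) : E :=
  ω.eval ⟨T, right_mem_Icc.2 hT⟩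

/-- The time change `r ↦ s + r` from `[0, t - s]` to `[0, 1]`. -/
def shiftTime (s t : I) (r : Icc (0 : ℝ) ((t : ℝ) - s)) : Icc (0 : ℝ) 1 :=
  ⟨s + r, add_nonneg s.2.1 r.2.1, by have := r.2.2; have := t.2.2; linarith⟩

theorem continuous_shiftTime (s t : I) : Continuous (shiftTime s t) :=
  (continuous_const.add continuous_subtype_val).subtype_mk _

theorem strictMono_shiftTime (s t : I) : StrictMono (shiftTime s t) :=
  fun _ _ h => Subtype.mk_lt_mk.2 (add_lt_add_right (Subtype.coe_lt_coe.2 h) _)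

/-- The part of a path on `[0, 1]` between times `s` and `t`, as a path on `[0, t - s]`:
`r ↦ ω (s + r)`. -/
def PathSpace.segment {k : PathKind} {E : Type*} [TopologicalSpace E] (s t : I)
    (ω : PathSpace k 1 E) : PathSpace k ((t : ℝ) - s) E :=
  match k, ω with
  | .continuous, ω => ContinuousMap.comp ω ⟨shiftTime s t, continuous_shiftTime s t⟩
  | .rcll, ω =>
    { toFun := fun r => RCLLPath.toFun ω (shiftTime s t r)
      rightCont := fun r => (RCLLPath.rightCont ω (shiftTime s t r)).comp
        (continuous_shiftTime s t).continuousWithinAt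
        fun _ h => (strictMono_shiftTime s t).monotone h
      leftLim := fun r => (RCLLPath.leftLim ω (shiftTime s t r)).imp fun _ hl =>
        hl.comp (tendsto_nhdsWithin_iff.2
          ⟨(continuous_shiftTime s t).continuousAt.tendsto.mono_left nhdsWithin_le_nhds,
            eventually_nhdsWithin_of_forall fun _ h => strictMono_shiftTime s t h⟩) }

/-- The `σ`-algebra on the path space over `[0, 1]` generated by the canonical process up to
time `s`. -/
@[reducible]
def past {k : PathKind} {E : Type*} [TopologicalSpace E] [MeasurableSpace E] (s : I) :
    MeasurableSpace (PathSpace k 1 E) :=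
  ⨆ r : Iic s, MeasurableSpace.comap (PathSpace.eval (r : I)) inferInstance

/-- The laws on the path space over `[0, 1]` whose marginal at time `t` is `μ`. -/
def marginalSet (k : PathKind) {E : Type*} [PseudoEMetricSpace E] [MeasurableSpace E]
    (t : I) (μ : ProbabilityMeasure E) : Set (ProbabilityMeasure (PathSpace k 1 E)) :=
  {P | (P : Measure (PathSpace k 1 E)).map (PathSpace.eval t) = μ}

/-- `κ` is a regular conditional distribution, under `P`, of the path between `s` and `t` given the
path up to time `s`. -/
structure IsCondLawGivenPast {k : PathKind} {E : Type*} [PseudoEMetricSpace E] [MeasurableSpace E]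
    (P : ProbabilityMeasure (PathSpace k 1 E)) (s t : I)
    (κ : PathSpace k 1 E → ProbabilityMeasure (PathSpace k ((t : ℝ) - s) E)) : Prop where
  measurable : ∀ B, MeasurableSet B →
    Measurable[past s] fun ω => (κ ω : Measure (PathSpace k ((t : ℝ) - s) E)) B
  setLIntegral_eq : ∀ B, MeasurableSet B → ∀ F, MeasurableSet[past s] F →
    ∫⁻ ω in F, (κ ω : Measure (PathSpace k ((t : ℝ) - s) E)) B ∂(P : Measure (PathSpace k 1 E)) =
      (P : Measure (PathSpace k 1 E)) (F ∩ PathSpace.segment s t ⁻¹' B)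

/-- The laws `P` on the path space over `[0, 1]` such that for `P`-almost every `ω` the conditional
law of the path between `s` and `t`, given the path up to time `s`, belongs to `G (ω s)`. (Regular
conditional distributions exist and are almost surely unique here, so it does not matter which
version is taken.) -/
def constraintSet {k : PathKind} {E : Type*} [PseudoEMetricSpace E] [MeasurableSpace E] (s t : I)
    (G : E → Set (ProbabilityMeasure (PathSpace k ((t : ℝ) - s) E))) :
    Set (ProbabilityMeasure (PathSpace k 1 E)) :=
  {P | ∃ κ, IsCondLawGivenPast P s t κ ∧
    ∀ᵐ ω ∂(P : Measure (PathSpace k 1 E)), κ ω ∈ G (PathSpace.eval s ω)}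

/-- The laws of the path between `s` and `t`, under the laws in `S`. -/
def segmentLaws {k : PathKind} {E : Type*} [PseudoEMetricSpace E] (s t : I)
    (S : Set (ProbabilityMeasure (PathSpace k 1 E))) :
    Set (ProbabilityMeasure (PathSpace k ((t : ℝ) - s) E)) :=
  {Q | ∃ P ∈ S, (Q : Measure (PathSpace k ((t : ℝ) - s) E)) =
    (P : Measure (PathSpace k 1 E)).map (PathSpace.segment s t)}

/-- `f^G (x)`, the infimum over `Q ∈ G x` of the expectation under `Q` of `f` at the final
position. -/
def lowerExpectation {k : PathKind} {T : ℝ} (hT : 0 ≤ T) {E : Type*} [PseudoEMetricSpace E]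
    (G : E → Set (ProbabilityMeasure (PathSpace k T E))) (f : E →ᵇ ℝ) (x : E) : ℝ :=
  ⨅ Q : G x, ∫ ω : PathSpace k T E, f (ω.final hT)
    ∂((Q : ProbabilityMeasure (PathSpace k T E)) : Measure (PathSpace k T E))

/-- Weak continuity of `t ↦ α t` for continuous paths, weak right continuity for RCLL paths. -/
def MarginalsRegular (k : PathKind) {E : Type*} [TopologicalSpace E] [MeasurableSpace E]
    [OpensMeasurableSpace E] (α : I → ProbabilityMeasure E) : Prop :=
  match k with
  | .continuous => Continuous α
  | .rcll => ∀ t, ContinuousWithinAt α (Ici t) t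

theorem sub_nonneg_of_lt {s t : I} (h : s < t) : 0 ≤ (t : ℝ) - s :=
  sub_nonneg.2 (Subtype.coe_le_coe.2 h.le)

end ConstrainedPeacock

end

open ConstrainedPeacock

/-! Necessity: if `P` lies in all the sets, its conditional law on `[s, t]` competes in the infimum
defining `lowerExpectation` at the position at time `s`; integrating this inequality gives the claim
(`integral_lowerExpectation_le`).

Sufficiency: consistency puts `constraintSet 0 1` inside every other constraint set, so it is enough
to find a law there with all the marginals. The engine is Hahn-Banach (`exists_forall_le_integral`):
in a convex compact set of laws, a system of lower bounds on integrals of bounded continuous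
functions is solvable as soon as each finite nonnegative combination is approximately solvable. For
prescribing the marginal at time `t`, a combination of test functions is a single function `h`. A
measurable, almost optimal choice from `Γ s t` for `-h` (`exists_continuation`) continues a given
law from `s` to `t` with expectation of `-h` at most that under `α t` plus `ε`, by the assumed
inequality. The selection rests on universal measurability of analytic sets and Jankov-von Neumann.

There are two obstacles. The compact set consists of laws on `[0, t]` for which only the initial
marginal is fixed, so the limiting law may have another past than the law being continued. Moreover,
evaluation at an interior time is not continuous for the Skorokhod topology, so interior marginals
are not closed conditions. Both are met by replacing `f (ω u)` with the penalized supremum `sup_r (f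
(ω r) - m |r - u|)`. For Lipschitz `f` it is continuous and dominates `f (ω u)`, hence the bound
that its expectation is at least the integral of `f` under `α u` survives weak limits and later
continuations. Induction over the times (`exists_law_finset`) and compactness (`exists_law`) give
one law with these bounds at all interior times and the exact marginal at time `1`.

If `u` decreases to `t` while `m` grows like `1 / (u - t)`, the penalized supremum tends to `f (ω
t)` by right continuity of paths, and the bounds become a one-sided inequality for the marginal at
`t` by right continuity of `α`. Applied to `f` and `-f` it is an equality
(`mem_marginalSet_of_penalizedBound`). -/

namespace ConstrainedPeacock

/-! ### Analytic sets: universal measurability and measurable selection -/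

section Analytic

section LeastPoint

variable {X : Type*}

/-- The sequences that begin with the reversed list `l`. -/
def initialSet : List ℕ → Set (ℕ → ℕ)
  | [] => univ
  | k :: l => initialSet l ∩ {z | z l.length = k}

theorem isOpen_initialSet : ∀ l : List ℕ, IsOpen (initialSet l)
  | [] => isOpen_univ
  | k :: l => (isOpen_initialSet l).inter (by
    simpa [preimage] using (isOpen_discrete {k}).preimage (continuous_apply (A := fun _ => ℕ) l.length))

/-- The reversed list of the first `n` terms of the lexicographically least point of the fibre
of `φ` over `x`. -/
noncomputable def leastInitial (φ : (ℕ → ℕ) → X) (x : X) : ℕ → List ℕ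
  | 0 => []
  | n + 1 => sInf {k | x ∈ φ '' initialSet (k :: leastInitial φ x n)} :: leastInitial φ x n

theorem length_leastInitial (φ : (ℕ → ℕ) → X) (x : X) (n : ℕ) : (leastInitial φ x n).length = n := by
  induction n with
  | zero => rfl
  | succ n ih => simp [leastInitial, ih]

theorem mem_image_leastInitial {φ : (ℕ → ℕ) → X} {x : X} (hx : x ∈ range φ) (n : ℕ) :
    x ∈ φ '' initialSet (leastInitial φ x n) := by
  induction n with
  | zero => simpa [leastInitial, initialSet] using hx
  | succ n ih =>
    obtain ⟨z, hz, rfl⟩ := ih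
    exact Nat.sInf_mem (s := {k | φ z ∈ φ '' initialSet (k :: leastInitial φ (φ z) n)})
      ⟨z (leastInitial φ (φ z) n).length, z, ⟨hz, rfl⟩, rfl⟩

/-- The lexicographically least point of the fibre of `φ` over `x`. -/
noncomputable def leastPoint (φ : (ℕ → ℕ) → X) (x : X) (n : ℕ) : ℕ :=
  (leastInitial φ x (n + 1)).headI

theorem eq_leastPoint_of_mem {φ : (ℕ → ℕ) → X} {x : X} {n : ℕ} {z : ℕ → ℕ}
    (hz : z ∈ initialSet (leastInitial φ x n)) : ∀ i < n, z i = leastPoint φ x i := by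
  induction n with
  | zero => simp
  | succ n ih =>
    refine Nat.forall_lt_succ_right.2 ⟨ih hz.1, ?_⟩
    have := hz.2
    rwa [mem_ofPred_eq, length_leastInitial] at this

/-- Every initial segment of the least point extends to some point of the fibre. These points
converge to the least point, so continuity of `φ` keeps the limit in the fibre. -/
theorem apply_leastPoint [TopologicalSpace X] [T2Space X] {φ : (ℕ → ℕ) → X} (hφ : Continuous φ) {x : X}
    (hx : x ∈ range φ) : φ (leastPoint φ x) = x := by
  choose z hz hzx using mem_image_leastInitial hx
  have hlim : Tendsto z atTop (𝓝 (leastPoint φ x)) := by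
    refine tendsto_pi_nhds.2 fun i => tendsto_const_nhds.congr' ?_
    filter_upwards [eventually_gt_atTop i] with n hn
    exact (eq_leastPoint_of_mem (hz n) i hn).symm
  have h1 := (hφ.tendsto _).comp hlim
  exact tendsto_nhds_unique h1 (tendsto_const_nhds.congr fun n => (hzx n).symm)

theorem nullMeasurableSet_sInf_eq [MeasurableSpace X] {μ : Measure X} {B : ℕ → Set X}
    (hB : ∀ k, NullMeasurableSet (B k) μ) (k : ℕ) :
    NullMeasurableSet {x | sInf {j | x ∈ B j} = k} μ := by
  -- The last part accounts for `sInf ∅ = 0`: points in none of the sets count for `k = 0`.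
  have : {x | sInf {j | x ∈ B j} = k} =
      (B k ∩ ⋂ j : Iio k, (B j)ᶜ) ∪ ((⋂ j, (B j)ᶜ) ∩ {_x | k = 0}) := by
    ext x
    simp only [mem_ofPred_eq, mem_union, mem_inter_iff, mem_iInter, mem_compl_iff, Subtype.forall,
      mem_Iio]
    constructor
    · rintro rfl
      rcases eq_empty_or_nonempty {j | x ∈ B j} with h | h
      · right
        refine ⟨fun j hj => by rw [eq_empty_iff_forall_notMem] at h; exact h j hj, by simp [h]⟩
      · exact Or.inl ⟨Nat.sInf_mem h, fun j hj => Nat.notMem_of_lt_sInf hj⟩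
    · rintro (⟨h1, h2⟩ | ⟨h1, rfl⟩)
      · refine le_antisymm (Nat.sInf_le h1) ?_
        by_contra! hlt
        exact h2 _ hlt (Nat.sInf_mem (s := {j | x ∈ B j}) ⟨k, h1⟩)
      · simp [h1]
  rw [this]
  refine ((hB k).inter (NullMeasurableSet.iInter fun j : Iio k => (hB j).compl)).union
    ((NullMeasurableSet.iInter fun j => (hB j).compl).inter ?_)
  exact (MeasurableSet.const _).nullMeasurableSet

end LeastPoint

variable {X : Type*} [TopologicalSpace X] [TopologicalSpace.MetrizableSpace X] [MeasurableSpace X]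
  [BorelSpace X]

/-- If all the images of the sets `{z | ∀ i < k, z i ≤ n i}` have measure larger than `c`, so does
(weakly) the image of the compact set `{z | ∀ i, z i ≤ n i}`. -/
theorem le_measure_image_Iic {φ : (ℕ → ℕ) → X} (hφ : Continuous φ) (μ : Measure X)
    [IsFiniteMeasure μ] (n : ℕ → ℕ) {c : ℝ≥0∞} (h : ∀ k, c < μ (φ '' {z | ∀ i < k, z i ≤ n i})) :
    c ≤ μ (φ '' Iic n) := by
  have hK : IsCompact (Iic n) := by
    have : Iic n = Set.pi univ fun i => Iic (n i) := by
      ext z; simp [Pi.le_def]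
    rw [this]
    exact isCompact_univ_pi fun i => (finite_Iic _).isCompact
  by_contra! hlt
  obtain ⟨V, hKV, hV, hμV⟩ := Set.exists_isOpen_lt_of_lt _ _ hlt
  -- Otherwise pick, for each `k`, a point outside `φ ⁻¹' V` whose first `k` coordinates are bounded
  -- by `n`. Truncating it at `n` does not alter those coordinates, and a cluster point of the
  -- truncations has a cylinder inside `φ ⁻¹' V`.
  have key : ∃ k, {z : ℕ → ℕ | ∀ i < k, z i ≤ n i} ⊆ φ ⁻¹' V := by
    by_contra! hno
    choose z hz hzV using fun k => not_subset.1 (hno k)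
    obtain ⟨w, hw, hcl⟩ := hK.exists_mapClusterPt (f := atTop)
      (u := fun k i => min (z k i) (n i))
      (Filter.le_principal_iff.2 (Filter.mem_map.2
        (Filter.univ_mem' fun k => by intro i; exact min_le_right _ _)))
    have hwV : φ w ∈ V := hKV (mem_image_of_mem _ hw)
    obtain ⟨m, hm⟩ : ∃ m, PiNat.cylinder w m ⊆ φ ⁻¹' V := by
      obtain ⟨m, hm⟩ := (PiNat.isOpen_iff_dist (E := fun _ => ℕ) (φ ⁻¹' V)).1
        (hV.preimage hφ) w hwV |>.imp fun _ h => h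
      obtain ⟨N, hN⟩ := exists_pow_lt_of_lt_one hm.1 (one_half_lt_one)
      refine ⟨N, fun y hy => hm.2 y ?_⟩
      have := (PiNat.mem_cylinder_iff_dist_le (x := w) (y := y) (n := N)).1 hy
      rw [PiNat.dist_comm]
      exact this.trans_lt hN
    have hfr := hcl.frequently
      ((PiNat.isOpen_cylinder (fun _ => ℕ) w m).mem_nhds (PiNat.self_mem_cylinder w m))
    obtain ⟨k, hk, hkm⟩ := (hfr.and_eventually (eventually_ge_atTop m)).exists
    refine hzV k (hm fun i hi => ?_)
    rw [← hk i hi]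
    exact (min_eq_left (hz k i (hi.trans_le hkm))).symm
  obtain ⟨k, hk⟩ := key
  exact absurd ((h k).trans_le (measure_mono (image_subset_iff.2 hk))) hμV.not_gt

/-- The coordinates are bounded one after the other. Continuity from below also holds for the outer
measure of arbitrary increasing sets, so each new bound can keep the image larger than `c` although
the images are not known to be measurable. -/
theorem exists_isCompact_le_measure_image {φ : (ℕ → ℕ) → X} (hφ : Continuous φ) (μ : Measure X)
    [IsFiniteMeasure μ] {c : ℝ≥0∞} (hc : c < μ (range φ)) :
    ∃ K : Set (ℕ → ℕ), IsCompact K ∧ c ≤ μ (φ '' K) := by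
  have step : ∀ (k : ℕ) (A : Set (ℕ → ℕ)), c < μ (φ '' A) →
      ∃ m, c < μ (φ '' (A ∩ {z | z k ≤ m})) := by
    intro k A hA
    have h1 : φ '' A = ⋃ m, φ '' (A ∩ {z | z k ≤ m}) := by
      rw [← image_iUnion, ← inter_iUnion]
      congr 1
      refine (inter_eq_left.2 fun z _ => mem_iUnion.2 ⟨z k, by simp⟩).symm
    have hmono : Monotone fun m => φ '' (A ∩ {z | z k ≤ m}) := fun a b hab =>
      image_mono (inter_subset_inter_right _ fun z (hz : z k ≤ a) => hz.trans hab)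
    rw [h1, hmono.measure_iUnion] at hA
    exact lt_iSup_iff.1 hA
  choose m hm using step
  let A : ℕ → {A : Set (ℕ → ℕ) // c < μ (φ '' A)} := fun k =>
    Nat.rec ⟨univ, by rwa [image_univ]⟩
      (fun k A => ⟨A.1 ∩ {z | z k ≤ m k A.1 A.2}, hm k A.1 A.2⟩) k
  let n : ℕ → ℕ := fun k => m k (A k).1 (A k).2
  have hA : ∀ k, (A k).1 = {z | ∀ i < k, z i ≤ n i} := by
    intro k
    induction k with
    | zero => simp [A]
    | succ k ih =>
      change (A k).1 ∩ {z | z k ≤ n k} = _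
      rw [ih]
      ext z
      simp only [mem_inter_iff, mem_ofPred_eq]
      exact Nat.forall_lt_succ_right.symm
  refine ⟨Iic n, ?_, le_measure_image_Iic hφ μ n fun k => hA k ▸ (A k).2⟩
  have : Iic n = Set.pi univ fun i => Iic (n i) := by
    ext z; simp [Pi.le_def]
  rw [this]
  exact isCompact_univ_pi fun i => (finite_Iic _).isCompact

/-- Analytic sets are universally measurable. -/
theorem nullMeasurableSet_of_analyticSet {s : Set X} (hs : AnalyticSet s) (μ : Measure X)
    [IsFiniteMeasure μ] : NullMeasurableSet s μ := by
  rw [AnalyticSet] at hs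
  obtain rfl | ⟨φ, hφ, rfl⟩ := hs
  · exact nullMeasurableSet_empty
  rcases eq_or_ne (μ (range φ)) 0 with h0 | h0
  · exact NullMeasurableSet.of_null h0
  -- Levels `c j` increasing to the outer measure of the range yield countably many compact subsets
  -- that exhaust it up to a null set.
  obtain ⟨c, -, hc, hlim⟩ := exists_seq_strictMono_tendsto' (pos_iff_ne_zero.2 h0)
  choose K hK hcK using fun j => exists_isCompact_le_measure_image hφ μ (hc j).2
  have hM : MeasurableSet (⋃ j, φ '' K j) :=
    MeasurableSet.iUnion fun j => ((hK j).image hφ).isClosed.measurableSet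
  have hsub : (⋃ j, φ '' K j) ⊆ range φ := iUnion_subset fun j => image_subset_range _ _
  refine (NullMeasurableSet.congr hM.nullMeasurableSet ?_)
  refine ae_eq_of_subset_of_measure_ge hsub ?_ hM.nullMeasurableSet (measure_ne_top _ _)
  exact le_of_tendsto' hlim fun j => (hcK j).trans (measure_mono (subset_iUnion (fun j => φ '' K j) j))

theorem nullMeasurableSet_leastInitial {φ : (ℕ → ℕ) → X} (hφ : Continuous φ) (μ : Measure X)
    [IsFiniteMeasure μ] (n : ℕ) (l : List ℕ) :
    NullMeasurableSet {x | leastInitial φ x n = l} μ := by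
  induction n generalizing l with
  | zero => exact (MeasurableSet.const ([] = l)).nullMeasurableSet
  | succ n ih =>
    cases l with
    | nil => simp [leastInitial]
    | cons k l =>
      have : {x | leastInitial φ x (n + 1) = k :: l} =
          {x | leastInitial φ x n = l} ∩ {x | sInf {j | x ∈ φ '' initialSet (j :: l)} = k} := by
        ext x
        simp only [leastInitial, List.cons.injEq, mem_ofPred_eq, mem_inter_iff]
        constructor
        · rintro ⟨h1, h2⟩; rw [h2] at h1; exact ⟨h2, h1⟩
        · rintro ⟨h1, h2⟩; rw [h1]; exact ⟨h2, rfl⟩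
      rw [this]
      exact (ih l).inter (nullMeasurableSet_sInf_eq (fun j => nullMeasurableSet_of_analyticSet
        ((isOpen_initialSet _).analyticSet_image hφ) μ) k)

theorem aemeasurable_leastPoint {φ : (ℕ → ℕ) → X} (hφ : Continuous φ) (μ : Measure X)
    [IsFiniteMeasure μ] : AEMeasurable (leastPoint φ) μ := by
  refine aemeasurable_pi_iff.2 fun n => NullMeasurable.aemeasurable fun s _ => ?_
  have : (fun x => leastPoint φ x n) ⁻¹' s =
      ⋃ l : {l : List ℕ // l.headI ∈ s}, {x | leastInitial φ x (n + 1) = l} := by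
    ext x; simp [leastPoint]
  rw [this]
  exact .iUnion fun l => nullMeasurableSet_leastInitial hφ μ _ _

/-- **Jankov-von Neumann selection**: a continuous function on `ℕ → ℕ` has a measurable section,
up to a null set. -/
theorem exists_measurable_section {φ : (ℕ → ℕ) → X} (hφ : Continuous φ) (μ : Measure X)
    [IsFiniteMeasure μ] :
    ∃ h : X → ℕ → ℕ, Measurable h ∧ ∀ᵐ x ∂μ, x ∈ range φ → φ (h x) = x := by
  obtain ⟨h, hm, hae⟩ := aemeasurable_leastPoint hφ μ
  refine ⟨h, hm, ?_⟩
  filter_upwards [hae] with x hx hxr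
  rw [← hx, apply_leastPoint hφ hxr]

variable {Y : Type*} [TopologicalSpace Y]

/-- The infimum of a continuous function over the sections of an analytic set is universally
measurable. -/
theorem aemeasurable_iInf_section {G : X → Set Y} (hG : AnalyticSet {p : X × Y | p.2 ∈ G p.1})
    {h : Y → ℝ} (hh : Continuous h) (hbdd : BddBelow (range h)) (hne : ∀ x, (G x).Nonempty)
    (μ : Measure X) [IsFiniteMeasure μ] : AEMeasurable (fun x => ⨅ y : G x, h y) μ := by
  refine NullMeasurable.aemeasurable ?_
  have hlt : ∀ c : ℝ, NullMeasurableSet {x | ⨅ y : G x, h y < c} μ := by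
    intro c
    refine nullMeasurableSet_of_analyticSet ?_ μ
    rw [AnalyticSet] at hG
    -- An infimum is below `c` exactly if some competitor is, so the sublevel set is the projection
    -- of an analytic set.
    have hset : {x | ⨅ y : G x, h y < c} =
        Prod.fst '' ({p : X × Y | p.2 ∈ G p.1} ∩ {p | h p.2 < c}) := by
      ext x
      have : Nonempty (G x) := (hne x).to_subtype
      have hb : BddBelow (range fun y : G x => h y) := hbdd.mono (range_comp_subset_range _ h)
      simp only [mem_ofPred_eq, ciInf_lt_iff hb]
      simp
    rw [hset]
    obtain h0 | ⟨φ, hφ, hr⟩ := hG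
    · rw [h0, empty_inter, image_empty]; exact analyticSet_empty
    · rw [← hr, ← image_univ, ← image_inter_preimage, univ_inter, image_image]
      exact ((isOpen_Iio.preimage (hh.comp continuous_snd)).preimage hφ).analyticSet_image
        (continuous_fst.comp hφ)
  have hm : ∀ s ∈ range (Iio : ℝ → Set ℝ),
      NullMeasurableSet ((fun x => ⨅ y : G x, h y) ⁻¹' s) μ := by
    rintro _ ⟨c, rfl⟩; exact hlt c
  have hgen : Measurable[_, MeasurableSpace.generateFrom (range (Iio : ℝ → Set ℝ))]
      (fun x : NullMeasurableSpace X μ => ⨅ y : G x, h y) :=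
    @measurable_generateFrom _ _ _ _ _ hm
  intro s hs
  rw [borel_eq_generateFrom_Iio ℝ |> fun h => (BorelSpace.measurable_eq (α := ℝ)).trans h] at hs
  exact hgen hs

/-- Almost optimal measurable selection from an analytic set. -/
theorem exists_measurable_almost_optimal [Nonempty X] {G : X → Set Y}
    (hG : AnalyticSet {p : X × Y | p.2 ∈ G p.1})
    {h : Y → ℝ} (hh : Continuous h) (hbdd : BddBelow (range h)) (hne : ∀ x, (G x).Nonempty)
    (μ : Measure X) [IsFiniteMeasure μ] {ε : ℝ} (hε : 0 < ε) :
    ∃ (z : X → ℕ → ℕ) (c : (ℕ → ℕ) → Y), Measurable z ∧ Continuous c ∧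
      ∀ᵐ x ∂μ, c (z x) ∈ G x ∧ h (c (z x)) < (⨅ y : G x, h y) + ε := by
  obtain ⟨v, hv, hvae⟩ := aemeasurable_iInf_section hG hh hbdd hne μ
  have hGne : {p : X × Y | p.2 ∈ G p.1}.Nonempty := by
    obtain ⟨x⟩ := ‹Nonempty X›
    obtain ⟨y, hy⟩ := hne x
    exact ⟨(x, y), hy⟩
  rw [AnalyticSet] at hG
  obtain ⟨φ, hφ, hr⟩ := hG.resolve_left hGne.ne_empty
  -- With the measurable version `v` in place of the infimum, the almost optimal parameters form a
  -- Borel set. It is therefore a continuous image of `ℕ → ℕ`, and the section theorem applies to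
  -- its projection.
  have hZ : MeasurableSet {z | h (φ z).2 < v (φ z).1 + ε} :=
    measurableSet_lt (hh.comp (continuous_snd.comp hφ)).measurable
      ((hv.comp (continuous_fst.comp hφ).measurable).add_const _)
  have hcov : ∀ x, ⨅ y : G x, h y = v x → ∃ z, h (φ z).2 < v (φ z).1 + ε ∧ (φ z).1 = x := by
    intro x hx
    have : Nonempty (G x) := (hne x).to_subtype
    obtain ⟨y, hy⟩ := exists_lt_of_ciInf_lt (f := fun y : G x => h y)
      (a := v x + ε) (by rw [hx]; linarith)
    obtain ⟨z, hz⟩ : ((x, (y : Y)) : X × Y) ∈ range φ := by rw [hr]; exact y.2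
    exact ⟨z, by rw [hz]; exact hy, by rw [hz]⟩
  have hA := hZ.analyticSet
  rw [AnalyticSet] at hA
  obtain h0 | ⟨ψ, hψ, hψr⟩ := hA
  · refine ⟨fun _ => 0, fun z => (φ z).2, measurable_const, continuous_snd.comp hφ, ?_⟩
    filter_upwards [hvae] with x hx
    obtain ⟨z, hz, -⟩ := hcov x hx
    exact absurd hz (eq_empty_iff_forall_notMem.1 h0 z)
  obtain ⟨z, hz, hzae⟩ := exists_measurable_section
    (continuous_fst.comp (hφ.comp hψ)) μ
  refine ⟨z, fun w => (φ (ψ w)).2, hz, continuous_snd.comp (hφ.comp hψ), ?_⟩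
  filter_upwards [hvae, hzae] with x hx hxz
  have hxr : x ∈ range (Prod.fst ∘ φ ∘ ψ) := by
    obtain ⟨w, hw, hwx⟩ := hcov x hx
    obtain ⟨w', rfl⟩ : w ∈ range ψ := by rw [hψr]; exact hw
    exact ⟨w', hwx⟩
  have hx1 : (φ (ψ (z x))).1 = x := hxz hxr
  have h1 : φ (ψ (z x)) ∈ {p : X × Y | p.2 ∈ G p.1} := hr ▸ mem_range_self _
  have h2 : ψ (z x) ∈ {z | h (φ z).2 < v (φ z).1 + ε} := hψr ▸ mem_range_self _
  simp only [mem_ofPred_eq, hx1] at h1 h2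
  exact ⟨h1, by rw [hx]; exact h2⟩

end Analytic

/-- The measure of a measurable set depends measurably on the parameter of a continuous family of
laws. -/
theorem measurable_measure_of_continuous {Z Ω : Type*} [TopologicalSpace Z] [MeasurableSpace Z]
    [BorelSpace Z] [TopologicalSpace Ω] [MeasurableSpace Ω] [BorelSpace Ω]
    [HasOuterApproxClosed Ω] {c : Z → ProbabilityMeasure Ω} (hc : Continuous c) :
    Measurable fun z => (c z : Measure Ω) := by
  refine Measurable.measure_of_isPiSystem_of_isProbabilityMeasure
    ((BorelSpace.measurable_eq (α := Ω)).trans borel_eq_generateFrom_isClosed)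
    isPiSystem_isClosed fun F hF => ?_
  refine measurable_of_tendsto_metrizable (f := fun n z => ∫⁻ x, hF.apprSeq n x ∂(c z : Measure Ω))
    (fun n => Continuous.measurable ?_)
    (tendsto_pi_nhds.2 fun z => HasOuterApproxClosed.tendsto_lintegral_apprSeq hF _)
  refine continuous_iff_continuousAt.2 fun z => ?_
  exact (ProbabilityMeasure.tendsto_iff_forall_lintegral_tendsto.1 (hc.tendsto z)) _

/-! ### The Skorokhod space: evaluations and step approximations -/

section Skorokhod

variable {T : ℝ} {E : Type*}

theorem exists_timeChange_of_edist_lt [PseudoMetricSpace E] {x y : RCLLPath T E} {a : ℝ}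
    (h : edist x y < ENNReal.ofReal a) :
    ∃ τ : Icc (0 : ℝ) T ≃o Icc (0 : ℝ) T, (∀ t, dist (τ t) t < a) ∧
      ∀ t, dist (x.toFun t) (y.toFun (τ t)) < a := by
  obtain ⟨τ, hτ⟩ := iInf_lt_iff.1 (show skorokhodEDist x y < _ from h)
  obtain ⟨h1, h2⟩ := max_lt_iff.1 hτ
  refine ⟨τ, fun t => ?_, fun t => ?_⟩
  · exact edist_lt_ofReal.1 ((le_iSup (fun t => edist (τ t) t) t).trans_lt h1)
  · exact edist_lt_ofReal.1
      ((le_iSup (fun t => edist (x.toFun t) (y.toFun (τ t))) t).trans_lt h2)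

theorem edist_le_of_timeChange [PseudoMetricSpace E] {x y : RCLLPath T E} {a : ℝ}
    (τ : Icc (0 : ℝ) T ≃o Icc (0 : ℝ) T) (h1 : ∀ t, dist (τ t) t ≤ a)
    (h2 : ∀ t, dist (x.toFun t) (y.toFun (τ t)) ≤ a) : edist x y ≤ ENNReal.ofReal a := by
  refine (iInf_le _ τ).trans (sup_le (iSup_le fun t => ?_) (iSup_le fun t => ?_))
  · rw [edist_dist]; exact ENNReal.ofReal_le_ofReal (h1 t)
  · rw [edist_dist]; exact ENNReal.ofReal_le_ofReal (h2 t)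

/-- Open windows in time and in space both absorb the small displacement caused by a time change.
This replaces the missing continuity of single evaluations. -/
theorem isOpen_exists_mem_Ioo [PseudoMetricSpace E] (a b : ℝ) {U : Set E} (hU : IsOpen U) :
    IsOpen {x : RCLLPath T E | ∃ r : Icc (0 : ℝ) T, a < r ∧ (r : ℝ) < b ∧ x.toFun r ∈ U} := by
  rw [EMetric.isOpen_iff]
  rintro x ⟨r, har, hrb, hrU⟩
  obtain ⟨δ, hδ, hball⟩ := Metric.isOpen_iff.1 hU _ hrU
  refine ⟨ENNReal.ofReal (min δ (min (r - a) (b - r))), ?_, fun y hy => ?_⟩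
  · simp [hδ, har, hrb]
  · rw [Metric.mem_eball, edist_comm] at hy
    obtain ⟨τ, h1, h2⟩ := exists_timeChange_of_edist_lt hy
    have h3 := h1 r
    have h4 := h2 r
    simp only [lt_min_iff] at h3 h4
    rw [Subtype.dist_eq, Real.dist_eq, abs_lt, abs_lt, abs_lt] at h3
    refine ⟨τ r, by linarith [h3.2.1.1], by linarith [h3.2.2.2], hball ?_⟩
    rw [Metric.mem_ball, dist_comm]
    exact h4.1

/-- An order isomorphism of `[0, T]` fixes `T`, so the Skorokhod distance dominates the distance of
the final positions. -/
theorem continuous_final_rcll [PseudoMetricSpace E] (hT : 0 ≤ T) :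
    Continuous fun x : RCLLPath T E => x.toFun ⟨T, right_mem_Icc.2 hT⟩ := by
  have : LipschitzWith 1 fun x : RCLLPath T E => x.toFun ⟨T, right_mem_Icc.2 hT⟩ := by
    intro x y
    rw [ENNReal.coe_one, one_mul]
    refine le_iInf fun τ => le_sup_of_le_right ?_
    refine le_trans (le_of_eq ?_) (le_iSup _ (⟨T, right_mem_Icc.2 hT⟩ : Icc (0 : ℝ) T))
    have hτ : τ ⟨T, right_mem_Icc.2 hT⟩ = ⟨T, right_mem_Icc.2 hT⟩ := by
      refine le_antisymm (Subtype.mk_le_mk.2 (τ _).2.2) ?_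
      rw [← τ.symm_apply_le]
      exact Subtype.mk_le_mk.2 (τ.symm _).2.2
    simp only [hτ]
  exact this.continuous

/-- By right continuity, a path is in the open set `U` at time `t < T` if and only if it stays at
some definite distance from the complement just after `t`. With rational-type thresholds this is a
countable union of closed conditions. -/
theorem measurable_eval_rcll [PseudoMetricSpace E] [MeasurableSpace E] [BorelSpace E]
    (t : Icc (0 : ℝ) T) : Measurable[borel (RCLLPath T E)] fun x : RCLLPath T E => x.toFun t := by
  let : MeasurableSpace (RCLLPath T E) := borel _
  have : BorelSpace (RCLLPath T E) := ⟨rfl⟩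
  rcases eq_or_lt_of_le t.2.2 with htT | htT
  · have h0 : 0 ≤ T := htT ▸ t.2.1
    have : t = ⟨T, right_mem_Icc.2 h0⟩ := Subtype.ext htT
    rw [this]
    exact (continuous_final_rcll h0).measurable
  refine measurable_of_isOpen fun U hU => ?_
  rcases eq_or_ne U univ with rfl | hU'
  · simp
  have hne : Uᶜ.Nonempty := nonempty_compl.2 hU'
  have key : (fun x : RCLLPath T E => x.toFun t) ⁻¹' U = ⋃ (m : ℕ) (n : ℕ),
      {x : RCLLPath T E | ∃ r : Icc (0 : ℝ) T, (t : ℝ) < r ∧ (r : ℝ) < t + 1 / (n + 1) ∧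
        x.toFun r ∈ {e | Metric.infDist e Uᶜ < 1 / ((m : ℝ) + 1)}}ᶜ := by
    ext x
    simp only [mem_preimage, mem_iUnion, mem_compl_iff, mem_ofPred_eq, not_exists, not_and, not_lt]
    constructor
    · intro hx
      have hpos : 0 < Metric.infDist (x.toFun t) Uᶜ :=
        (hU.isClosed_compl.notMem_iff_infDist_pos hne).1 (by simpa using hx)
      obtain ⟨m, hm⟩ := exists_nat_one_div_lt hpos
      have hev : ∀ᶠ r in 𝓝[≥] t, 1 / ((m : ℝ) + 1) < Metric.infDist (x.toFun r) Uᶜ :=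
        ((Metric.continuous_infDist_pt _).continuousAt.tendsto.comp (x.rightCont t)).eventually
          (lt_mem_nhds hm)
      obtain ⟨δ, hδ, hball⟩ := Metric.mem_nhdsWithin_iff.1 hev
      obtain ⟨n, hn⟩ := exists_nat_one_div_lt hδ
      refine ⟨m, n, fun r h1 h2 => le_of_lt (hball ⟨?_, Subtype.coe_le_coe.1 h1.le⟩)⟩
      rw [Metric.mem_ball, Subtype.dist_eq, Real.dist_eq, abs_lt]
      constructor <;> linarith
    · rintro ⟨m, n, h⟩
      have : (𝓝[>] t).NeBot := by
        refine mem_closure_iff_nhdsWithin_neBot.1 (Metric.mem_closure_iff.2 fun ε hε => ?_)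
        have h1 : (t : ℝ) < min T (t + ε / 2) := lt_min htT (by linarith)
        refine ⟨⟨min T (t + ε / 2), t.2.1.trans h1.le, min_le_left _ _⟩,
          show (t : ℝ) < min T (t + ε / 2) from h1, ?_⟩
        rw [dist_comm, Subtype.dist_eq, Real.dist_eq, abs_of_pos (by simpa using h1)]
        have := min_le_right T (t + ε / 2)
        simp only
        linarith
      have hge : 1 / ((m : ℝ) + 1) ≤ Metric.infDist (x.toFun t) Uᶜ := by
        refine ge_of_tendsto (x := 𝓝[>] t) (((Metric.continuous_infDist_pt _).continuousAt.tendsto.comp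
          (x.rightCont t)).mono_left (nhdsWithin_mono _ Ioi_subset_Ici_self)) ?_
        have hn : (0 : ℝ) < 1 / (n + 1) := by positivity
        filter_upwards [self_mem_nhdsWithin,
          mem_nhdsWithin_of_mem_nhds (Metric.ball_mem_nhds t hn)] with r h1 h2
        rw [Metric.mem_ball, Subtype.dist_eq, Real.dist_eq, abs_lt] at h2
        exact h r h1 (by linarith [h2.2])
      by_contra hx
      have : Metric.infDist (x.toFun t) Uᶜ = 0 := Metric.infDist_zero_of_mem hx
      have : (0 : ℝ) < 1 / (m + 1) := by positivity
      linarith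
  rw [key]
  refine .iUnion fun m => .iUnion fun n => (IsOpen.measurableSet ?_).compl
  exact isOpen_exists_mem_Ioo _ _
    ((isOpen_Iio (a := 1 / ((m : ℝ) + 1))).preimage (Metric.continuous_infDist_pt _))

/-- A path oscillates little between consecutive points of a suitable finite set. -/
theorem RCLLPath.exists_finset_oscillation [PseudoMetricSpace E] (x : RCLLPath T E) {ε : ℝ}
    (hε : 0 < ε) : ∃ S : Finset ℝ, ∀ r s : Icc (0 : ℝ) T,
      (∀ p ∈ S, p ≤ r ↔ p ≤ s) → dist (x.toFun r) (x.toFun s) < ε := by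
  classical
  have hloc : ∀ t : Icc (0 : ℝ) T, ∃ δ > 0, ∀ r s : Icc (0 : ℝ) T,
      ((t : ℝ) - δ ≤ r ∧ r < t ∧ (t : ℝ) - δ ≤ s ∧ s < t) ∨
        (t ≤ r ∧ (r : ℝ) < t + δ ∧ t ≤ s ∧ (s : ℝ) < t + δ) →
      dist (x.toFun r) (x.toFun s) < ε := by
    intro t
    obtain ⟨l, hl⟩ := x.leftLim t
    obtain ⟨δ₁, h1, hb1⟩ := Metric.mem_nhdsWithin_iff.1
      (hl.eventually (Metric.ball_mem_nhds l (half_pos hε)))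
    obtain ⟨δ₂, h2, hb2⟩ := Metric.mem_nhdsWithin_iff.1
      ((x.rightCont t).eventually (Metric.ball_mem_nhds (x.toFun t) (half_pos hε)))
    refine ⟨min δ₁ δ₂ / 2, by positivity, ?_⟩
    have hm1 := min_le_left δ₁ δ₂
    have hm2 := min_le_right δ₁ δ₂
    have hm0 : 0 < min δ₁ δ₂ := lt_min h1 h2
    have hL : ∀ r : Icc (0 : ℝ) T, (t : ℝ) - min δ₁ δ₂ / 2 ≤ r → r < t →
        dist (x.toFun r) l < ε / 2 := fun r ha hb => hb1 ⟨by
      have hb' : (r : ℝ) < t := hb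
      rw [Metric.mem_ball, Subtype.dist_eq, Real.dist_eq, abs_lt]; constructor <;> linarith, hb⟩
    have hR : ∀ r : Icc (0 : ℝ) T, t ≤ r → (r : ℝ) < t + min δ₁ δ₂ / 2 →
        dist (x.toFun r) (x.toFun t) < ε / 2 := fun r ha hb => hb2 ⟨by
      have ha' : (t : ℝ) ≤ r := ha
      rw [Metric.mem_ball, Subtype.dist_eq, Real.dist_eq, abs_lt]; constructor <;> linarith, ha⟩
    rintro r s (⟨a, b, c, d⟩ | ⟨a, b, c, d⟩)
    · have := dist_triangle_right (x.toFun r) (x.toFun s) l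
      linarith [hL r a b, hL s c d]
    · have := dist_triangle_right (x.toFun r) (x.toFun s) (x.toFun t)
      linarith [hR r a b, hR s c d]
  choose δ hδ hosc using hloc
  obtain ⟨F, -, hF⟩ := (isCompact_univ (X := Icc (0 : ℝ) T)).elim_nhds_subcover
    (fun t => Metric.ball t (δ t)) fun t _ => Metric.ball_mem_nhds t (hδ t)
  -- The cut points `t - δ t`, `t`, `t + δ t` of a finite subcover: two times not separated by any
  -- of them lie in the same half-open interval `[t - δ t, t)` or `[t, t + δ t)`.
  refine ⟨F.image (fun t : Icc (0 : ℝ) T => (t : ℝ)) ∪ F.image (fun t : Icc (0 : ℝ) T => (t : ℝ) - δ t) ∪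
    F.image (fun t : Icc (0 : ℝ) T => (t : ℝ) + δ t), fun r s hrs => ?_⟩
  obtain ⟨t, htF, hrt⟩ := mem_iUnion₂.1 (hF (mem_univ r))
  have e1 := hrs t (by simp only [Finset.mem_union, Finset.mem_image]; exact .inl (.inl ⟨t, htF, rfl⟩))
  have e2 := hrs (t - δ t)
    (by simp only [Finset.mem_union, Finset.mem_image]; exact .inl (.inr ⟨t, htF, rfl⟩))
  have e3 := hrs (t + δ t)
    (by simp only [Finset.mem_union, Finset.mem_image]; exact .inr ⟨t, htF, rfl⟩)
  rw [Metric.mem_ball, Subtype.dist_eq, Real.dist_eq, abs_lt] at hrt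
  refine hosc t r s ?_
  rcases le_or_gt t r with htr | htr
  · exact .inr ⟨htr, by linarith, e1.1 htr, not_le.1 fun h => absurd (e3.2 h) (by linarith)⟩
  · refine .inl ⟨by linarith, htr, e2.1 (by linarith), not_le.1 fun h => ?_⟩
    exact absurd (e1.2 h) (not_le.2 htr)

theorem exists_pos_separation (S : Finset ℝ) :
    ∃ δ > 0, ∀ p ∈ S, ∀ q ∈ S, p ≠ q → 3 * δ ≤ |p - q| := by
  classical
  rcases (S.offDiag).eq_empty_or_nonempty with h | h
  · refine ⟨1, one_pos, fun p hp q hq hpq => ?_⟩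
    have : (p, q) ∈ S.offDiag := Finset.mem_offDiag.2 ⟨hp, hq, hpq⟩
    simp [h] at this
  · obtain ⟨⟨p, q⟩, hpq, hmin⟩ := S.offDiag.exists_min_image (fun z => |z.1 - z.2|) h
    have hne := (Finset.mem_offDiag.1 hpq).2.2
    refine ⟨|p - q| / 3, by have := abs_pos.2 (sub_ne_zero.2 hne); positivity,
      fun p' hp' q' hq' h' => ?_⟩
    have := hmin (p', q') (Finset.mem_offDiag.2 ⟨hp', hq', h'⟩)
    simp only at this
    linarith

theorem exists_orderIso_of_strictMono (hT : 0 ≤ T) {f : ℝ → ℝ} (hf : StrictMono f)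
    (hc : Continuous f) (h0 : f 0 = 0) (h1 : f T = T) :
    ∃ τ : Icc (0 : ℝ) T ≃o Icc (0 : ℝ) T, ∀ t, (τ t : ℝ) = f t := by
  let g : Icc (0 : ℝ) T → Icc (0 : ℝ) T := fun t =>
    ⟨f t, h0.symm.trans_le (hf.monotone t.2.1), (hf.monotone t.2.2).trans h1.le⟩
  have hg : StrictMono g := fun a b hab => Subtype.mk_lt_mk.2 (hf hab)
  have hsurj : Function.Surjective g := by
    intro y
    obtain ⟨z, hz, hzy⟩ := intermediate_value_Icc hT hc.continuousOn
      (show (y : ℝ) ∈ Icc (f 0) (f T) by rw [h0, h1]; exact y.2)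
    exact ⟨⟨z, hz⟩, Subtype.ext hzy⟩
  exact ⟨hg.orderIsoOfSurjective g hsurj, fun t => rfl⟩

/-- A trapezoid of height `1` around `p`. -/
noncomputable def bump (δ p x : ℝ) : ℝ := max 0 (min 1 (2 - |x - p| / δ))

theorem abs_bump_le (δ p x : ℝ) : |bump δ p x| ≤ 1 := by
  unfold bump
  rw [abs_of_nonneg (le_max_left _ _)]
  exact max_le zero_le_one (min_le_left _ _)

theorem abs_bump_sub_le {δ : ℝ} (hδ : 0 < δ) (p x y : ℝ) :
    |bump δ p x - bump δ p y| ≤ |x - y| / δ := by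
  unfold bump
  refine (abs_max_sub_max_le_max _ _ _ _).trans (max_le (by simp; positivity) ?_)
  refine (abs_min_sub_min_le_max _ _ _ _).trans (max_le (by simp; positivity) ?_)
  rw [sub_sub_sub_cancel_left, ← sub_div, abs_div, abs_of_pos hδ]
  have := abs_abs_sub_abs_le_abs_sub (y - p) (x - p)
  rw [sub_sub_sub_cancel_right, abs_sub_comm y x] at this
  exact div_le_div_of_nonneg_right this hδ.le

theorem bump_eq_one {δ p x : ℝ} (hδ : 0 < δ) (h : |x - p| ≤ δ) : bump δ p x = 1 := by
  have : |x - p| / δ ≤ 1 := (div_le_one hδ).2 h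
  unfold bump
  rw [min_eq_left (by linarith), max_eq_right zero_le_one]

theorem bump_eq_zero {δ p x : ℝ} (hδ : 0 < δ) (h : 2 * δ ≤ |x - p|) : bump δ p x = 0 := by
  have : 2 ≤ |x - p| / δ := (le_div_iff₀ hδ).2 h
  unfold bump
  rw [min_eq_right (by linarith), max_eq_left (by linarith)]

/-- A time change that moves prescribed nearby points to the points of a finite set. -/
theorem exists_timeChange (hT : 0 ≤ T) (S : Finset ℝ) {ε : ℝ} (hε : 0 < ε) :
    ∃ η > 0, ∀ a : ℝ → ℝ, a 0 = 0 → a T = T → (∀ p, |a p - p| ≤ η) →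
      ∃ τ : Icc (0 : ℝ) T ≃o Icc (0 : ℝ) T, (∀ t, dist (τ t) t ≤ ε) ∧
        ∀ p ∈ S, ∀ t : Icc (0 : ℝ) T, a p ≤ t ↔ p ≤ τ t := by
  classical
  set S' := insert 0 (insert T S) with hS'
  obtain ⟨δ, hδ, hsep⟩ := exists_pos_separation S'
  set N : ℝ := (S'.card : ℝ) + 1 with hN
  have hN0 : 0 < N := by positivity
  -- The map is the identity plus bumps of height `p - a p`. The bound `δ` puts `a p` on the plateau
  -- of its own bump, and separation by `3 * δ` keeps it off the supports of the others; `δ / (2 *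
  -- N)` makes the perturbation `1 / 2`-Lipschitz, hence the sum strictly increasing; `ε / N` makes
  -- it at most `ε`. The points `0` and `T` were added to fix the ends.
  refine ⟨min δ (min (δ / (2 * N)) (ε / N)), by positivity, fun a ha0 haT ha => ?_⟩
  set η := min δ (min (δ / (2 * N)) (ε / N)) with hη
  have hηδ : η ≤ δ := min_le_left _ _
  have hη1 : η ≤ δ / (2 * N) := (min_le_right _ _).trans (min_le_left _ _)
  have hη2 : η ≤ ε / N := (min_le_right _ _).trans (min_le_right _ _)
  have hη0 : 0 ≤ η := (abs_nonneg _).trans (ha 0)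
  set θ : ℝ → ℝ := fun x => ∑ p ∈ S', (p - a p) * bump δ p x with hθ
  have hθle : ∀ x, |θ x| ≤ ε := by
    intro x
    calc |θ x| ≤ ∑ p ∈ S', |(p - a p) * bump δ p x| := Finset.abs_sum_le_sum_abs _ _
      _ ≤ ∑ p ∈ S', η := by
        refine Finset.sum_le_sum fun p _ => ?_
        rw [abs_mul, abs_sub_comm]
        exact (mul_le_mul (ha p) (abs_bump_le _ _ _) (abs_nonneg _) hη0).trans (mul_one _).le
      _ = (S'.card : ℝ) * η := by simp
      _ ≤ N * (ε / N) := by gcongr; linarith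
      _ = ε := by field_simp
  have hθlip : ∀ x y, |θ x - θ y| ≤ 1 / 2 * |x - y| := by
    intro x y
    calc |θ x - θ y| = |∑ p ∈ S', (p - a p) * (bump δ p x - bump δ p y)| := by
          simp only [hθ, ← Finset.sum_sub_distrib, mul_sub]
      _ ≤ ∑ p ∈ S', |(p - a p) * (bump δ p x - bump δ p y)| := Finset.abs_sum_le_sum_abs _ _
      _ ≤ ∑ p ∈ S', η * (|x - y| / δ) := by
        refine Finset.sum_le_sum fun p _ => ?_
        rw [abs_mul, abs_sub_comm]
        exact mul_le_mul (ha p) (abs_bump_sub_le hδ _ _ _) (abs_nonneg _) hη0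
      _ = (S'.card : ℝ) * (η * (|x - y| / δ)) := by simp
      _ ≤ N * (δ / (2 * N) * (|x - y| / δ)) := by gcongr; linarith
      _ = 1 / 2 * |x - y| := by field_simp
  have hcont : Continuous fun x => x + θ x := by
    refine continuous_id.add (LipschitzWith.of_dist_le_mul (K := 1 / 2) fun x y => ?_).continuous
    simpa [Real.dist_eq] using hθlip x y
  have hmono : StrictMono fun x => x + θ x := by
    intro x y hxy
    have := hθlip x y
    rw [abs_sub_comm x y, abs_of_pos (sub_pos.2 hxy)] at this
    have := (abs_le.1 this).2
    simp only
    linarith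
  have hval : ∀ q ∈ S', a q + θ (a q) = q := by
    intro q hq
    have : θ (a q) = q - a q := by
      simp only [hθ]
      rw [Finset.sum_eq_single_of_mem q hq, bump_eq_one hδ ((ha q).trans hηδ), mul_one]
      intro p hp hpq
      rw [bump_eq_zero hδ, mul_zero]
      have h1 := hsep q hq p hp hpq.symm
      have h2 := abs_sub_abs_le_abs_sub (q - p) (q - a q)
      have h3 := (ha q).trans hηδ
      rw [abs_sub_comm] at h3
      rw [sub_sub_sub_cancel_left] at h2
      linarith
    rw [this]; ring
  obtain ⟨τ, hτ⟩ := exists_orderIso_of_strictMono hT hmono hcont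
    (by have := hval 0 (by simp [hS']); rwa [ha0] at this)
    (by have := hval T (by simp [hS']); rwa [haT] at this)
  refine ⟨τ, fun t => ?_, fun p hp t => ?_⟩
  · rw [Subtype.dist_eq, Real.dist_eq, hτ]
    simpa using hθle t
  · have := hval p (by simp [hS', hp])
    rw [hτ]
    nth_rw 2 [← this]
    exact (hmono.le_iff_le).symm

/-- The number of the interval of length `T / n` that contains a time. -/
noncomputable def stepIndex (T : ℝ) (n : ℕ) (t : ℝ) : Fin (n + 1) :=
  ⟨min n ⌊t * n / T⌋.toNat, Nat.lt_succ_of_le (min_le_left _ _)⟩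

/-- The step path with given values. -/
noncomputable def stepPath [TopologicalSpace E] (hT : 0 < T) (n : ℕ) (v : Fin (n + 1) → E) :
    RCLLPath T E where
  toFun t := v (stepIndex T n t)
  rightCont t := by
    have h1 : Tendsto (fun s : Icc (0 : ℝ) T => (s : ℝ) * n / T) (𝓝[≥] t)
        (𝓝[≥] ((t : ℝ) * n / T)) := by
      refine tendsto_nhdsWithin_iff.2 ⟨?_, eventually_nhdsWithin_of_forall fun s hs => ?_⟩
      · exact Continuous.continuousWithinAt (by fun_prop)
      · have hs' : (t : ℝ) ≤ s := hs
        simp only [mem_Ici]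
        gcongr
    have h2 := tendsto_pure.1 ((tendsto_floor_right_pure_floor _).comp h1)
    refine tendsto_const_nhds.congr' ?_
    filter_upwards [h2] with s hs
    simp only [Function.comp] at hs
    simp only [stepIndex, hs]
  leftLim t := by
    rcases Nat.eq_zero_or_pos n with rfl | hn
    · refine ⟨v 0, tendsto_const_nhds.congr fun s => ?_⟩
      exact congrArg v (Subsingleton.elim (α := Fin 1) _ _)
    have h1 : Tendsto (fun s : Icc (0 : ℝ) T => (s : ℝ) * n / T) (𝓝[<] t)
        (𝓝[<] ((t : ℝ) * n / T)) := by
      refine tendsto_nhdsWithin_iff.2 ⟨?_, eventually_nhdsWithin_of_forall fun s hs => ?_⟩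
      · exact Continuous.continuousWithinAt (by fun_prop)
      · have hs' : (s : ℝ) < t := hs
        have : (0 : ℝ) < n := by exact_mod_cast hn
        simp only [mem_Iio]
        gcongr
    have h2 := tendsto_pure.1 ((tendsto_floor_left_pure_ceil_sub_one _).comp h1)
    refine ⟨v ⟨min n (⌈(t : ℝ) * n / T⌉ - 1).toNat, Nat.lt_succ_of_le (min_le_left _ _)⟩,
      tendsto_const_nhds.congr' ?_⟩
    filter_upwards [h2] with s hs
    simp only [Function.comp] at hs
    simp only [stepIndex, hs]

theorem continuous_stepPath [PseudoMetricSpace E] (hT : 0 < T) (n : ℕ) :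
    Continuous (stepPath (E := E) hT n) := by
  have : LipschitzWith 1 (stepPath (E := E) hT n) := by
    intro v w
    rw [ENNReal.coe_one, one_mul]
    refine (iInf_le _ (OrderIso.refl _)).trans (sup_le ?_ ?_)
    · simp
    · exact iSup_le fun t => edist_le_pi_edist v w _
  exact this.continuous

/-- The multiples of `T / n`. -/
noncomputable def gridTime (hT : 0 < T) (n : ℕ) (j : Fin (n + 1)) : Icc (0 : ℝ) T :=
  ⟨j * T / n, by positivity, by
    rcases Nat.eq_zero_or_pos n with rfl | hn
    · simpa using hT.le
    · have hn' : (0 : ℝ) < n := by exact_mod_cast hn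
      have : ((j : ℕ) : ℝ) ≤ n := by exact_mod_cast Nat.lt_succ_iff.1 j.2
      rw [div_le_iff₀ hn', mul_comm]
      gcongr⟩

theorem gridTime_stepIndex (hT : 0 < T) {n : ℕ} (hn : 0 < n) (t : Icc (0 : ℝ) T) :
    (gridTime hT n (stepIndex T n t) : ℝ) = ⌊(t : ℝ) * n / T⌋ * T / n := by
  have hn' : (0 : ℝ) < n := by exact_mod_cast hn
  have h0 : 0 ≤ ⌊(t : ℝ) * n / T⌋ := Int.floor_nonneg.2 (by have := t.2.1; positivity)
  have h1 : (t : ℝ) * n / T ≤ n := by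
    rw [div_le_iff₀ hT, mul_comm]; have := t.2.2; gcongr
  have h2 : ⌊(t : ℝ) * n / T⌋.toNat ≤ n := by
    have : ⌊(t : ℝ) * n / T⌋ ≤ (n : ℤ) := Int.floor_le_iff.2 (by push_cast; linarith)
    omega
  simp only [gridTime, stepIndex, min_eq_right h2]
  congr 2
  have : ((⌊(t : ℝ) * n / T⌋.toNat : ℤ) : ℝ) = ⌊(t : ℝ) * n / T⌋ := by rw [Int.toNat_of_nonneg h0]
  exact_mod_cast this

/-- Paths are limits of their step approximations. -/
theorem tendsto_stepPath [PseudoMetricSpace E] (hT : 0 < T) (x : RCLLPath T E) :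
    Tendsto (fun n => stepPath hT n fun j => x.toFun (gridTime hT n j)) atTop (𝓝 x) := by
  refine EMetric.tendsto_nhds.2 fun ε' hε' => ?_
  obtain ⟨ε, hε, hεε'⟩ : ∃ ε : ℝ, 0 < ε ∧ ENNReal.ofReal ε < ε' := by
    obtain ⟨ε, h1, h2⟩ := ENNReal.lt_iff_exists_nnreal_btwn.1 hε'
    exact ⟨ε, by exact_mod_cast h1, by simpa using h2⟩
  obtain ⟨S, hS⟩ := x.exists_finset_oscillation hε
  obtain ⟨η, hη, hτ⟩ := exists_timeChange hT.le S hε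
  have hlim : Tendsto (fun n : ℕ => T / (n : ℝ)) atTop (𝓝 0) := tendsto_const_div_atTop_nhds_zero_nat T
  filter_upwards [eventually_gt_atTop 0, hlim.eventually (gt_mem_nhds hη)] with n hn hnη
  have hn' : (0 : ℝ) < n := by exact_mod_cast hn
  have hTn : (0 : ℝ) < n / T := by positivity
  -- The step path can only register a cut point `p` at the first grid time not before `p`. The time
  -- change moves that grid time back to `p`.
  obtain ⟨τ, h1, h2⟩ := hτ (fun p => ⌈p * n / T⌉ * T / n) (by simp) (by
      rw [mul_div_cancel_left₀ _ hT.ne', Int.ceil_natCast]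
      push_cast; field_simp) fun p => by
    have ha := Int.le_ceil (p * n / T)
    have hb := Int.ceil_lt_add_one (p * n / T)
    have hp : p = p * n / T * T / n := by field_simp
    have hd : (⌈p * n / T⌉ : ℝ) * T / n - p = (⌈p * n / T⌉ - p * n / T) * (T / n) := by
      conv_lhs => rw [hp]
      field_simp
    rw [hd, abs_of_nonneg (mul_nonneg (by linarith) (by positivity))]
    refine le_trans ?_ hnη.le
    exact mul_le_of_le_one_left (by positivity) (by linarith)
  refine (edist_le_of_timeChange τ h1 fun t => ?_).trans_lt hεε'
  refine (hS _ _ fun p hp => ?_).le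
  rw [gridTime_stepIndex hT hn, ← h2 p hp t]
  have e1 : p ≤ (⌊(t : ℝ) * n / T⌋ : ℝ) * T / n ↔ p * n / T ≤ ⌊(t : ℝ) * n / T⌋ := by
    rw [le_div_iff₀ hn', div_le_iff₀ hT]
  have e2 : (⌈p * n / T⌉ : ℝ) * T / n ≤ t ↔ (⌈p * n / T⌉ : ℝ) ≤ (t : ℝ) * n / T := by
    rw [div_le_iff₀ hn', le_div_iff₀ hT]
  rw [e1, e2, ← Int.ceil_le, ← Int.le_floor]

/-- A map into the Skorokhod space is measurable if all its evaluations are. -/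
theorem measurable_rcll_of_eval [PseudoMetricSpace E] [SecondCountableTopology E]
    [MeasurableSpace E] [BorelSpace E] (hT : 0 < T) {Z : Type*} [MeasurableSpace Z]
    {f : Z → RCLLPath T E} (hf : ∀ t, Measurable fun z => (f z).toFun t) :
    Measurable[_, borel (RCLLPath T E)] f := by
  let : MeasurableSpace (RCLLPath T E) := borel _
  have : BorelSpace (RCLLPath T E) := ⟨rfl⟩
  refine measurable_of_tendsto_metrizable
    (f := fun n z => stepPath hT n fun j => (f z).toFun (gridTime hT n j)) (fun n => ?_)
    (tendsto_pi_nhds.2 fun z => tendsto_stepPath hT (f z))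
  exact (continuous_stepPath hT n).measurable.comp (measurable_pi_lambda _ fun j => hf _)

end Skorokhod

/-! ### Path spaces of both kinds and the past -/

section PathSpace

variable {k : PathKind} {T : ℝ} {E : Type*}

instance [PseudoMetricSpace E] : TopologicalSpace.PseudoMetrizableSpace (PathSpace k T E) :=
  match k with
  | .continuous => inferInstanceAs (TopologicalSpace.PseudoMetrizableSpace C(Icc (0 : ℝ) T, E))
  | .rcll => inferInstanceAs (TopologicalSpace.PseudoMetrizableSpace (RCLLPath T E))

theorem PathSpace.ext [TopologicalSpace E] {ω η : PathSpace k T E}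
    (h : ∀ t, ω.eval t = η.eval t) : ω = η := by
  cases k with
  | continuous => exact ContinuousMap.ext h
  | rcll =>
    obtain ⟨f, _, _⟩ := ω
    obtain ⟨g, _, _⟩ := η
    obtain rfl : f = g := funext h
    rfl

theorem PathSpace.rightCont [TopologicalSpace E] (ω : PathSpace k T E) (t : Icc (0 : ℝ) T) :
    ContinuousWithinAt (fun r => ω.eval r) (Ici t) t := by
  cases k with
  | continuous => exact (ContinuousMap.continuous ω).continuousWithinAt
  | rcll => exact RCLLPath.rightCont ω t

@[simp]
theorem PathSpace.eval_segment [TopologicalSpace E] (s t : I) (ω : PathSpace k 1 E)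
    (r : Icc (0 : ℝ) ((t : ℝ) - s)) :
    (ω.segment s t).eval r = ω.eval (shiftTime s t r) := by
  cases k <;> rfl

/-- A path as an RCLL path. -/
def PathSpace.toRCLL [TopologicalSpace E] (ω : PathSpace k T E) : RCLLPath T E where
  toFun t := ω.eval t
  rightCont := ω.rightCont
  leftLim t := by
    cases k with
    | continuous =>
      exact ⟨_, (ContinuousMap.continuous ω).continuousAt.tendsto.mono_left nhdsWithin_le_nhds⟩
    | rcll => exact RCLLPath.leftLim ω t

theorem PathSpace.continuous_toRCLL [PseudoMetricSpace E] :
    Continuous (PathSpace.toRCLL : PathSpace k T E → RCLLPath T E) := by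
  cases k with
  | continuous =>
    have : LipschitzWith 1 (fun x : C(Icc (0 : ℝ) T, E) =>
        PathSpace.toRCLL (k := .continuous) x) := by
      intro x y
      rw [ENNReal.coe_one, one_mul]
      refine (iInf_le _ (OrderIso.refl _)).trans (sup_le ?_ (iSup_le fun t => ?_))
      · simp
      · rw [edist_dist, edist_dist]
        exact ENNReal.ofReal_le_ofReal (ContinuousMap.dist_apply_le_dist t)
    exact this.continuous
  | rcll => exact continuous_id

theorem PathSpace.continuous_final [PseudoMetricSpace E] (hT : 0 ≤ T) :
    Continuous (PathSpace.final hT : PathSpace k T E → E) :=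
  (continuous_final_rcll hT).comp continuous_toRCLL

theorem PathSpace.measurable_eval [PseudoMetricSpace E] [MeasurableSpace E] [BorelSpace E]
    (t : Icc (0 : ℝ) T) : Measurable (PathSpace.eval t : PathSpace k T E → E) := by
  let : MeasurableSpace (RCLLPath T E) := borel _
  have : BorelSpace (RCLLPath T E) := ⟨rfl⟩
  exact (measurable_eval_rcll t).comp continuous_toRCLL.measurable

/-- Membership in a closed ball is a condition at countably many times, by continuity, and every
open set is a countable union of closed balls, by separability. -/
theorem measurable_continuousMap_of_eval [PseudoMetricSpace E] [SecondCountableTopology E]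
    [MeasurableSpace E] [BorelSpace E] {Z : Type*} [MeasurableSpace Z]
    {f : Z → C(Icc (0 : ℝ) T, E)} (hf : ∀ t, Measurable fun z => f z t) :
    Measurable[_, borel C(Icc (0 : ℝ) T, E)] f := by
  let : MeasurableSpace C(Icc (0 : ℝ) T, E) := borel _
  have : BorelSpace C(Icc (0 : ℝ) T, E) := ⟨rfl⟩
  have hball : ∀ (y : C(Icc (0 : ℝ) T, E)) (r : ℝ), 0 ≤ r →
      MeasurableSet (f ⁻¹' Metric.closedBall y r) := by
    intro y r hr
    obtain ⟨D, hDc, hDd⟩ := TopologicalSpace.exists_countable_dense (Icc (0 : ℝ) T)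
    have : f ⁻¹' Metric.closedBall y r = ⋂ t ∈ D, {z | dist (f z t) (y t) ≤ r} := by
      ext z
      simp only [mem_preimage, Metric.mem_closedBall, mem_iInter, mem_ofPred_eq,
        ContinuousMap.dist_le hr]
      refine ⟨fun h t _ => h t, fun h t => ?_⟩
      have hcl : IsClosed {t | dist (f z t) (y t) ≤ r} := isClosed_le (by fun_prop) continuous_const
      have := hDd.closure_eq ▸ hcl.closure_subset_iff.2 (show D ⊆ {t | dist (f z t) (y t) ≤ r} from h)
      exact this (mem_univ t)
    rw [this]
    exact .biInter hDc fun t _ => measurableSet_le ((hf t).dist measurable_const) measurable_const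
  refine measurable_of_isOpen fun U hU => ?_
  have : ∀ y ∈ U, ∃ r > 0, Metric.closedBall y r ⊆ U := fun y hy =>
    Metric.nhds_basis_closedBall.mem_iff.1 (hU.mem_nhds hy)
  choose! r hr hrU using this
  obtain ⟨D, hDU, hDc, hDeq⟩ := TopologicalSpace.countable_cover_nhdsWithin (s := U)
    (f := fun y => Metric.closedBall y (r y))
    fun y hy => mem_nhdsWithin_of_mem_nhds (Metric.closedBall_mem_nhds y (hr y hy))
  have hUeq : U = ⋃ y ∈ D, Metric.closedBall y (r y) :=
    hDeq.antisymm (iUnion₂_subset fun y hy => hrU y (hDU hy))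
  rw [hUeq, preimage_iUnion₂]
  exact .biUnion hDc fun y hy => hball y _ (hr y (hDU hy)).le

/-- A map into a path space is measurable if all its evaluations are. -/
theorem PathSpace.measurable_of_eval [PseudoMetricSpace E] [SecondCountableTopology E]
    [MeasurableSpace E] [BorelSpace E] (hT : 0 < T) {Z : Type*} [MeasurableSpace Z]
    {f : Z → PathSpace k T E} (hf : ∀ t, Measurable fun z => (f z).eval t) : Measurable f := by
  cases k with
  | continuous => exact measurable_continuousMap_of_eval hf
  | rcll => exact measurable_rcll_of_eval hT hf

theorem PathSpace.measurable_segment [PseudoMetricSpace E] [SecondCountableTopology E]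
    [MeasurableSpace E] [BorelSpace E] {s t : I} (hst : s < t) :
    Measurable (PathSpace.segment s t : PathSpace k 1 E → _) :=
  measurable_of_eval (sub_pos.2 hst) fun r => by
    simpa using measurable_eval (shiftTime s t r)

theorem past_le [PseudoMetricSpace E] [MeasurableSpace E] [BorelSpace E] (s : I) :
    (past s : MeasurableSpace (PathSpace k 1 E)) ≤ borel (PathSpace k 1 E) :=
  iSup_le fun _ => (PathSpace.measurable_eval _).comap_le

theorem measurable_eval_past [TopologicalSpace E] [MeasurableSpace E] {s r : I} (hr : r ≤ s) :
    Measurable[past s] (PathSpace.eval r : PathSpace k 1 E → E) :=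
  (comap_measurable _).mono
    (le_iSup (fun r : Iic s => MeasurableSpace.comap (PathSpace.eval (k := k) (E := E) (r : I))
      inferInstance) ⟨r, hr⟩) le_rfl

/-- Events of the past only depend on the past. -/
theorem mem_iff_of_past [TopologicalSpace E] [MeasurableSpace E] {s : I}
    {F : Set (PathSpace k 1 E)} (hF : MeasurableSet[past s] F) {ω η : PathSpace k 1 E}
    (h : ∀ r ≤ s, ω.eval r = η.eval r) : ω ∈ F ↔ η ∈ F := by
  have hle : (past s : MeasurableSpace (PathSpace k 1 E)) ≤
      MeasurableSpace.comap (fun ω (r : Iic s) => (ω.eval (r : I) : E)) MeasurableSpace.pi := by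
    refine iSup_le fun r => Measurable.comap_le ?_
    exact (measurable_pi_apply (X := fun _ : Iic s => E) r).comp
      (comap_measurable fun (ω : PathSpace k 1 E) (r : Iic s) => ω.eval (r : I))
  obtain ⟨B, -, rfl⟩ := hle _ hF
  have : (fun (r : Iic s) => ω.eval (r : I)) = fun (r : Iic s) => η.eval (r : I) :=
    funext fun r => h r r.2
  simp only [mem_preimage, this]

/-- The penalized supremum `sup_r (f (ω r) - m |r - u|)`. -/
noncomputable def penalizedSup [TopologicalSpace E] (f : E → ℝ) (m u : ℝ) (ω : PathSpace k T E) :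
    ℝ :=
  ⨆ r : Icc (0 : ℝ) T, (f (ω.eval r) - m * |r - u|)

/-! ### Penalized suprema: continuous substitutes for evaluations -/

section Penalized

variable [PseudoMetricSpace E]

theorem bddAbove_penalized (f : E →ᵇ ℝ) {m : ℝ} (hm : 0 ≤ m) (u : ℝ)
    (ω : PathSpace k T E) :
    BddAbove (range fun r : Icc (0 : ℝ) T => f (ω.eval r) - m * |r - u|) := by
  refine ⟨‖f‖, ?_⟩
  rintro _ ⟨r, rfl⟩
  have := (le_abs_self _).trans (f.norm_coe_le_norm (ω.eval r))
  have : 0 ≤ m * |r - u| := by positivity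
  simp only
  linarith

theorem le_penalizedSup (f : E →ᵇ ℝ) {m : ℝ} (hm : 0 ≤ m) (u : ℝ)
    (ω : PathSpace k T E) (r : Icc (0 : ℝ) T) :
    f (ω.eval r) - m * |r - u| ≤ penalizedSup f m u ω :=
  le_ciSup (bddAbove_penalized f hm u ω) r

theorem penalizedSup_le_norm (f : E →ᵇ ℝ) {m : ℝ} (hm : 0 ≤ m) (u : ℝ)
    (hT : 0 ≤ T) (ω : PathSpace k T E) : penalizedSup f m u ω ≤ ‖f‖ := by
  have : Nonempty (Icc (0 : ℝ) T) := ⟨⟨0, left_mem_Icc.2 hT⟩⟩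
  refine ciSup_le fun r => ?_
  have := (le_abs_self _).trans (f.norm_coe_le_norm (ω.eval r))
  have : 0 ≤ m * |r - u| := by positivity
  linarith

/-- A time change of size `a` alters the position term by at most `L * a` and the penalty by at most
`m * a`. -/
theorem penalizedSup_le_add (f : E →ᵇ ℝ) {m : ℝ} (hm : 0 ≤ m) (u : ℝ)
    {L : ℝ≥0} (hL : LipschitzWith L f) {x y : RCLLPath T E} (hT : 0 ≤ T)
    {a : ℝ} (h : edist x y < ENNReal.ofReal a) :
    penalizedSup (k := .rcll) f m u x ≤ penalizedSup (k := .rcll) f m u y + (L + m) * a := by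
  have : Nonempty (Icc (0 : ℝ) T) := ⟨⟨0, left_mem_Icc.2 hT⟩⟩
  obtain ⟨τ, h1, h2⟩ := exists_timeChange_of_edist_lt h
  refine ciSup_le fun r => ?_
  have h3 := le_penalizedSup (k := .rcll) f hm u y (τ r)
  have h4 := (le_abs_self _).trans ((Real.dist_eq _ _).symm.trans_le
    ((hL.dist_le_mul (x.toFun r) (y.toFun (τ r))).trans
      (mul_le_mul_of_nonneg_left (h2 r).le L.2)))
  have h5 : |(τ r : ℝ) - u| ≤ |(r : ℝ) - u| + a := by
    have h6 := (h1 r).le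
    rw [Subtype.dist_eq, Real.dist_eq] at h6
    have := abs_sub_abs_le_abs_sub ((τ r : ℝ) - u) (r - u)
    rw [sub_sub_sub_cancel_right] at this
    linarith
  have h7 := mul_le_mul_of_nonneg_left h5 hm
  change f (x.toFun r) - _ ≤ _
  change f (y.toFun (τ r)) - _ ≤ _ at h3
  nlinarith

theorem continuous_penalizedSup (f : E →ᵇ ℝ) {m : ℝ} (hm : 0 ≤ m) (u : ℝ)
    {L : ℝ≥0} (hL : LipschitzWith L f) (hT : 0 ≤ T) :
    Continuous (penalizedSup f m u : PathSpace k T E → ℝ) := by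
  have hrcll : Continuous fun x : RCLLPath T E => penalizedSup (k := .rcll) f m u x := by
    refine continuous_iff_continuousAt.2 fun x => Metric.tendsto_nhds.2 fun ε hε => ?_
    have hK : 0 < (L : ℝ) + m + 1 := by positivity
    set a := ε / ((L : ℝ) + m + 1) with ha
    have ha0 : 0 < a := by positivity
    have haε : (L + m) * a < ε := by
      have : ((L : ℝ) + m + 1) * a = ε := by rw [ha]; field_simp
      nlinarith
    filter_upwards [Metric.eball_mem_nhds x (ENNReal.ofReal_pos.2 ha0)] with y hy
    have h1 := penalizedSup_le_add f hm u hL hT (show edist y x < _ from hy)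
    have h2 := penalizedSup_le_add f hm u hL hT (x := x) (y := y) (by rw [edist_comm]; exact hy)
    rw [Real.dist_eq, abs_lt]
    constructor <;> linarith
  exact hrcll.comp PathSpace.continuous_toRCLL

/-- The penalized supremum as a bounded continuous function. -/
noncomputable def penalizedBCF (f : E →ᵇ ℝ) {m : ℝ} (hm : 0 ≤ m) (u : ℝ)
    {L : ℝ≥0} (hL : LipschitzWith L f) (hT : 0 ≤ T) :
    PathSpace k T E →ᵇ ℝ :=
  BoundedContinuousFunction.ofNormedAddCommGroup (penalizedSup f m u)
    (continuous_penalizedSup f hm u hL hT) (‖f‖ + m * |u|) fun ω => by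
      rw [Real.norm_eq_abs, abs_le]
      have h1 := penalizedSup_le_norm f hm u hT ω
      -- The centre `u` may lie outside `[0, T]`, so the lower bound is read off at time `0`; hence
      -- the summand `m * |u|`.
      have h2 := le_penalizedSup f hm u ω ⟨0, left_mem_Icc.2 hT⟩
      have h3 := (abs_le.1 (f.norm_coe_le_norm (ω.eval ⟨0, left_mem_Icc.2 hT⟩))).1
      have h4 : 0 ≤ m * |u| := by positivity
      simp only [zero_sub, abs_neg] at h2
      constructor <;> linarith

end Penalized

/-- As the penalization becomes strong and the times approach from the right, the penalized
supremum tends to the value of the function along the path. -/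
theorem tendsto_penalizedSup [PseudoMetricSpace E] (f : E →ᵇ ℝ) (ω : PathSpace k T E)
    {t : Icc (0 : ℝ) T} {u : ℕ → Icc (0 : ℝ) T} (hu : ∀ n, t < u n)
    (hlim : Tendsto u atTop (𝓝 t)) :
    Tendsto (fun n => penalizedSup f (2 * ‖f‖ / (u n - t)) (u n) ω) atTop (𝓝 (f (ω.eval t))) := by
  have : Nonempty (Icc (0 : ℝ) T) := ⟨t⟩
  refine Metric.tendsto_nhds.2 fun ε hε => ?_
  have hev : ∀ᶠ r in 𝓝[≥] t, dist (f (ω.eval r)) (f (ω.eval t)) < ε / 2 :=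
    (f.continuous.continuousAt.tendsto.comp (ω.rightCont t)).eventually
      (Metric.ball_mem_nhds _ (half_pos hε))
  obtain ⟨δ, hδ, hball⟩ := Metric.mem_nhdsWithin_iff.1 hev
  filter_upwards [hlim.eventually (Metric.ball_mem_nhds t (half_pos hδ))] with n hn
  have hpos : 0 < (u n : ℝ) - t := sub_pos.2 (hu n)
  have hm : 0 ≤ 2 * ‖f‖ / ((u n : ℝ) - t) := by positivity
  rw [Subtype.dist_eq, Real.dist_eq, abs_of_pos hpos] at hn
  have hnear : ∀ r : Icc (0 : ℝ) T, |(r : ℝ) - u n| < u n - t →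
      |f (ω.eval r) - f (ω.eval t)| < ε / 2 := by
    intro r hr
    rw [abs_lt] at hr
    refine hball ⟨?_, show (t : ℝ) ≤ r by linarith⟩
    rw [Metric.mem_ball, Subtype.dist_eq, Real.dist_eq, abs_lt]
    constructor <;> linarith
  rw [Real.dist_eq, abs_lt]
  constructor
  · have h1 := le_penalizedSup f hm (u n) ω (u n)
    have h2 := (abs_lt.1 (hnear (u n) (by simpa using hu n))).1
    simp only [sub_self, abs_zero, mul_zero, sub_zero] at h1
    linarith
  · suffices penalizedSup f (2 * ‖f‖ / (u n - t)) (u n) ω ≤ f (ω.eval t) + ε / 2 by linarith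
    refine ciSup_le fun r => ?_
    -- Times nearer to `u n` than `t` is lie just to the right of `t`, where right continuity
    -- applies. At all others the penalty is at least `2 * ‖f‖`, so they cannot exceed `f (ω t)`.
    rcases lt_or_ge |(r : ℝ) - u n| (u n - t) with hr | hr
    · have h1 := (abs_lt.1 (hnear r hr)).2
      have : 0 ≤ 2 * ‖f‖ / ((u n : ℝ) - t) * |(r : ℝ) - u n| := by positivity
      linarith
    · have h1 := (abs_le.1 (f.norm_coe_le_norm (ω.eval r))).2
      have h2 := (abs_le.1 (f.norm_coe_le_norm (ω.eval t))).1
      have h3 := mul_le_mul_of_nonneg_left hr hm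
      rw [div_mul_cancel₀ _ hpos.ne'] at h3
      linarith

end PathSpace

/-- Finitely or infinitely many inequalities for integrals are solvable in a compact convex set of
laws if all nonnegative finite combinations are, approximately. -/
theorem exists_forall_le_integral {Y : Type*} [TopologicalSpace Y] [MeasurableSpace Y]
    [OpensMeasurableSpace Y] {S : Set (ProbabilityMeasure Y)} (hS : IsCompact S)
    (hconv : Convex ℝ≥0 (ProbabilityMeasure.toMeasure '' S)) {J : Type*} (g : J → Y →ᵇ ℝ)
    (c : J → ℝ)
    (H : ∀ (A : Finset J) (w : J → ℝ), (∀ j, 0 ≤ w j) → ∀ ε > 0, ∃ Q ∈ S,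
      ∑ j ∈ A, w j * c j - ε ≤ ∑ j ∈ A, w j * ∫ y, g j y ∂(Q : Measure Y)) :
    ∃ Q ∈ S, ∀ j, c j ≤ ∫ y, g j y ∂(Q : Measure Y) := by
  classical
  have hcont : ∀ j, Continuous fun Q : ProbabilityMeasure Y => ∫ y, g j y ∂(Q : Measure Y) :=
    fun j => ProbabilityMeasure.continuous_integral_boundedContinuousFunction (g j)
  suffices hfin : (S ∩ ⋂ j, {Q : ProbabilityMeasure Y | c j ≤ ∫ y, g j y ∂(Q : Measure Y)}).Nonempty by
    obtain ⟨Q, hQ, hQj⟩ := hfin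
    exact ⟨Q, hQ, fun j => mem_iInter.1 hQj j⟩
  refine hS.inter_iInter_nonempty _ (fun j => isClosed_le continuous_const (hcont j)) fun A => ?_
  by_contra hempty
  let Λ : ProbabilityMeasure Y → (A → ℝ) := fun Q j => ∫ y, g j y ∂(Q : Measure Y)
  have hΛ : Continuous Λ := continuous_pi fun j => hcont j
  have hΛconv : Convex ℝ (Λ '' S) := by
    rintro _ ⟨Q₁, h1, rfl⟩ _ ⟨Q₂, h2, rfl⟩ a b ha hb hab
    obtain ⟨Q, hQ, hQe⟩ := hconv (mem_image_of_mem _ h1) (mem_image_of_mem _ h2)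
      (zero_le (a := a.toNNReal)) (zero_le (a := b.toNNReal))
      (by rw [← Real.toNNReal_add ha hb, hab, Real.toNNReal_one])
    refine ⟨Q, hQ, funext fun j => ?_⟩
    have hQe' : (Q : Measure Y) = a.toNNReal • (Q₁ : Measure Y) + b.toNNReal • (Q₂ : Measure Y) := hQe
    simp only [Λ, hQe', Pi.add_apply, Pi.smul_apply, smul_eq_mul]
    rw [integral_add_measure ((g j).integrable _) ((g j).integrable _),
      integral_smul_nnreal_measure, integral_smul_nnreal_measure, NNReal.smul_def, NNReal.smul_def,
      Real.coe_toNNReal a ha, Real.coe_toNNReal b hb, smul_eq_mul, smul_eq_mul]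
  let O : Set (A → ℝ) := Ici fun j => c j
  have hdisj : Disjoint (Λ '' S) O := by
    refine Set.disjoint_left.2 ?_
    rintro _ ⟨Q, hQ, rfl⟩ hO
    exact hempty ⟨Q, hQ, mem_iInter₂.2 fun j hj => hO ⟨j, hj⟩⟩
  -- Separate the compact convex set of integral vectors from the orthant above `c`.
  obtain ⟨ℓ, u, v, hu, huv, hv⟩ := geometric_hahn_banach_compact_closed hΛconv (hS.image hΛ)
    (convex_Ici (fun j : A => c j)) isClosed_Ici hdisj
  have hsum : ∀ b : A → ℝ, ℓ b = ∑ j, ℓ (Pi.single j 1) * b j := by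
    intro b
    conv_lhs => rw [pi_eq_sum_univ' b, map_sum]
    refine Finset.sum_congr rfl fun j _ => ?_
    rw [map_smul, smul_eq_mul, mul_comm]
  -- A functional bounded below on an upward orthant has nonnegative coefficients, so they are
  -- admissible weights in `H`.
  have hw : ∀ j, 0 ≤ ℓ (Pi.single j 1) := by
    intro j
    by_contra! hneg
    obtain ⟨n, hn⟩ := exists_nat_gt ((ℓ (fun j => c j) - v) / -ℓ (Pi.single j 1))
    have hb := hv ((fun j : A => c j) + (n : ℝ) • Pi.single j (1 : ℝ)) (by
      refine mem_Ici.2 (le_add_of_nonneg_right (smul_nonneg n.cast_nonneg ?_))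
      exact Pi.single_nonneg.2 zero_le_one)
    rw [map_add, map_smul, smul_eq_mul] at hb
    rw [div_lt_iff₀ (neg_pos.2 hneg)] at hn
    linarith
  obtain ⟨Q, hQ, hle⟩ := H A (fun j => if h : j ∈ A then ℓ (Pi.single ⟨j, h⟩ 1) else 0)
    (fun j => by split_ifs with h; exacts [hw _, le_rfl]) (v - u) (sub_pos.2 huv)
  have hconvert : ∀ b : J → ℝ, ∑ j ∈ A, (if h : j ∈ A then ℓ (Pi.single ⟨j, h⟩ 1) else 0) * b j =
      ℓ fun j => b j := by
    intro b
    rw [hsum, ← Finset.sum_coe_sort A]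
    exact Finset.sum_congr rfl fun j _ => by rw [dif_pos j.2]
  rw [hconvert c, hconvert fun j => ∫ y, g j y ∂(Q : Measure Y)] at hle
  have h1 := hu _ (mem_image_of_mem Λ hQ)
  have h2 := hv (fun j => c j) self_mem_Ici
  change ℓ (Λ Q) < u at h1
  change _ ≤ ℓ (Λ Q) at hle
  linarith

/-! ### Concatenation of paths -/

section Concat

variable {k : PathKind} {E : Type*}

/-- The constant path. -/
def PathSpace.const (k : PathKind) (T : ℝ) [TopologicalSpace E] (x : E) : PathSpace k T E :=
  match k with
  | .continuous => ContinuousMap.const _ x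
  | .rcll => ⟨fun _ => x, fun _ => continuousWithinAt_const, fun _ => ⟨x, tendsto_const_nhds⟩⟩

@[simp]
theorem PathSpace.eval_const {T : ℝ} [TopologicalSpace E] (x : E) (t : Icc (0 : ℝ) T) :
    (PathSpace.const k T x).eval t = x := by
  cases k <;> rfl

theorem PathSpace.measurable_const {T : ℝ} (hT : 0 < T) [PseudoMetricSpace E]
    [SecondCountableTopology E] [MeasurableSpace E] [BorelSpace E] :
    Measurable (PathSpace.const k T : E → PathSpace k T E) :=
  measurable_of_eval hT fun t => by
    simp only [eval_const]
    exact measurable_id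

/-- The time change `r ↦ r - s` from `[0, 1]` to `[0, t - s]`, constant outside `[s, t]`. -/
noncomputable def backTime {s t : I} (hst : s < t) (r : I) : Icc (0 : ℝ) ((t : ℝ) - s) :=
  projIcc 0 ((t : ℝ) - s) (sub_nonneg_of_lt hst) (r - s)

theorem backTime_shiftTime {s t : I} (hst : s < t) (r : Icc (0 : ℝ) ((t : ℝ) - s)) :
    backTime hst (shiftTime s t r) = r := by
  simp only [backTime, shiftTime, add_sub_cancel_left]
  exact projIcc_val _ _

theorem backTime_of_le {s t : I} (hst : s < t) {r : I} (h : r ≤ s) :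
    backTime hst r = ⟨0, left_mem_Icc.2 (sub_nonneg_of_lt hst)⟩ :=
  projIcc_of_le_left _ (sub_nonpos.2 h)

theorem continuous_backTime {s t : I} (hst : s < t) : Continuous (backTime hst) :=
  continuous_projIcc.comp (by fun_prop)

theorem monotone_backTime {s t : I} (hst : s < t) : Monotone (backTime hst) :=
  fun _ _ h => monotone_projIcc _ (sub_le_sub_right (Subtype.coe_le_coe.2 h) _)

/-- Up to `t` the time change is strictly increasing, so approach from the left is preserved; beyond
`t` it is constant. -/
theorem RCLLPath.leftLim_comp_backTime [TopologicalSpace E] {s t : I} (hst : s < t)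
    (η : RCLLPath ((t : ℝ) - s) E) {r : I} (hr : s < r) :
    ∃ l, Tendsto (fun r => η.toFun (backTime hst r)) (𝓝[<] r) (𝓝 l) := by
  rcases le_or_gt r t with hrt | hrt
  · obtain ⟨l, hl⟩ := η.leftLim (backTime hst r)
    refine ⟨l, hl.comp (tendsto_nhdsWithin_iff.2
      ⟨(continuous_backTime hst).continuousAt.tendsto.mono_left nhdsWithin_le_nhds, ?_⟩)⟩
    filter_upwards [self_mem_nhdsWithin, mem_nhdsWithin_of_mem_nhds (Ioi_mem_nhds hr)] with q h1 h2
    have h1' : (q : ℝ) < r := h1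
    have h2' : (s : ℝ) < q := h2
    have h3' : (r : ℝ) ≤ t := hrt
    have ha : backTime hst q = ⟨q - s, by constructor <;> linarith⟩ :=
      projIcc_of_mem _ (by constructor <;> linarith)
    have hb : backTime hst r = ⟨r - s, by constructor <;> linarith⟩ :=
      projIcc_of_mem _ (by constructor <;> linarith)
    rw [ha, hb]
    exact show (q : ℝ) - s < r - s by linarith
  · refine ⟨η.toFun (backTime hst t), tendsto_const_nhds.congr' ?_⟩
    filter_upwards [mem_nhdsWithin_of_mem_nhds (Ioi_mem_nhds hrt)] with q hq
    have hq' : (t : ℝ) < q := hq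
    have ha : backTime hst q = ⟨t - s, right_mem_Icc.2 (sub_nonneg_of_lt hst)⟩ :=
      projIcc_of_right_le _ (by linarith)
    have hb : backTime hst t = ⟨t - s, right_mem_Icc.2 (sub_nonneg_of_lt hst)⟩ :=
      projIcc_of_right_le _ le_rfl
    rw [ha, hb]

open Classical in
theorem PathSpace.exists_concat [TopologicalSpace E] {s t : I} (hst : s < t) (ω : PathSpace k 1 E)
    (η : PathSpace k ((t : ℝ) - s) E) (h : η.start (sub_nonneg_of_lt hst) = ω.eval s) :
    ∃ ζ : PathSpace k 1 E, ∀ r : I,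
      ζ.eval r = if r ≤ s then ω.eval r else η.eval (backTime hst r) := by
  cases k with
  | continuous =>
    refine ⟨(⟨fun r => if r ≤ s then ContinuousMap.toFun ω r
      else ContinuousMap.toFun η (backTime hst r), ?_⟩ : C(Icc (0 : ℝ) 1, E)), fun r => rfl⟩
    refine Continuous.if_le (ContinuousMap.continuous ω)
      ((ContinuousMap.continuous η).comp (continuous_backTime hst)) continuous_id continuous_const ?_
    rintro r rfl
    rw [backTime_of_le hst le_rfl]
    exact h.symm
  | rcll =>
    refine ⟨(⟨fun r => if r ≤ s then RCLLPath.toFun ω r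
      else RCLLPath.toFun η (backTime hst r), fun r => ?_, fun r => ?_⟩ : RCLLPath 1 E),
      fun r => rfl⟩
    · rcases lt_or_ge r s with hr | hr
      · refine (RCLLPath.rightCont ω r).congr_of_eventuallyEq ?_ (if_pos hr.le)
        filter_upwards [mem_nhdsWithin_of_mem_nhds (Iio_mem_nhds hr)] with q hq
        exact if_pos (le_of_lt hq)
      · have heq : ∀ q ∈ Ici r, (if q ≤ s then RCLLPath.toFun ω q
            else RCLLPath.toFun η (backTime hst q)) = RCLLPath.toFun η (backTime hst q) := by
          intro q hq
          split_ifs with hqs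
          · obtain rfl : q = s := le_antisymm hqs (hr.trans hq)
            rw [backTime_of_le hst le_rfl]
            exact h.symm
          · rfl
        refine ContinuousWithinAt.congr ?_ heq (heq r self_mem_Ici)
        exact (RCLLPath.rightCont η _).comp (continuous_backTime hst).continuousWithinAt
          fun q hq => monotone_backTime hst hq
    · rcases le_or_gt r s with hr | hr
      · obtain ⟨l, hl⟩ := RCLLPath.leftLim ω r
        refine ⟨l, hl.congr' ?_⟩
        filter_upwards [self_mem_nhdsWithin] with q hq
        exact (if_pos ((le_of_lt hq).trans hr)).symm
      · obtain ⟨l, hl⟩ := RCLLPath.leftLim_comp_backTime hst η hr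
        refine ⟨l, hl.congr' ?_⟩
        filter_upwards [mem_nhdsWithin_of_mem_nhds (Ioi_mem_nhds hr)] with q hq
        exact (if_neg (not_le.2 hq)).symm

open Classical in
/-- Follow `ω` up to time `s`, then `η`, then stay constant; if `η` does not start where `ω` is at
time `s`, just follow `ω`. -/
noncomputable def PathSpace.concat [TopologicalSpace E] {s t : I} (hst : s < t)
    (ω : PathSpace k 1 E) (η : PathSpace k ((t : ℝ) - s) E) : PathSpace k 1 E :=
  if h : η.start (sub_nonneg_of_lt hst) = ω.eval s then (exists_concat hst ω η h).choose else ω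

open Classical in
theorem PathSpace.eval_concat [TopologicalSpace E] {s t : I} (hst : s < t)
    (ω : PathSpace k 1 E) (η : PathSpace k ((t : ℝ) - s) E) (r : I) :
    (ω.concat hst η).eval r = if η.start (sub_nonneg_of_lt hst) = ω.eval s then
      (if r ≤ s then ω.eval r else η.eval (backTime hst r)) else ω.eval r := by
  unfold concat
  split_ifs with h h'
  · rw [(exists_concat hst ω η h).choose_spec r, if_pos h']
  · rw [(exists_concat hst ω η h).choose_spec r, if_neg h']
  · rfl

theorem PathSpace.eval_concat_of_le [TopologicalSpace E] {s t : I} (hst : s < t)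
    (ω : PathSpace k 1 E) (η : PathSpace k ((t : ℝ) - s) E) {r : I} (hr : r ≤ s) :
    (ω.concat hst η).eval r = ω.eval r := by
  rw [eval_concat, if_pos hr, ite_self]

theorem PathSpace.segment_concat [TopologicalSpace E] {s t : I} (hst : s < t)
    (ω : PathSpace k 1 E) (η : PathSpace k ((t : ℝ) - s) E)
    (h : η.start (sub_nonneg_of_lt hst) = ω.eval s) : (ω.concat hst η).segment s t = η := by
  refine PathSpace.ext fun r => ?_
  rw [eval_segment, eval_concat, if_pos h]
  split_ifs with hr
  · have h1 : shiftTime s t r = s :=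
      le_antisymm hr (Subtype.coe_le_coe.1 (by simpa [shiftTime] using r.2.1))
    rw [h1, ← h, ← backTime_shiftTime hst r, h1, backTime_of_le hst le_rfl]
    rfl
  · rw [backTime_shiftTime]

theorem PathSpace.measurable_concat [MetricSpace E] [SecondCountableTopology E] [MeasurableSpace E]
    [BorelSpace E] {s t : I} (hst : s < t) :
    Measurable fun p : PathSpace k 1 E × PathSpace k ((t : ℝ) - s) E => p.1.concat hst p.2 := by
  classical
  refine measurable_of_eval one_pos fun r => ?_
  simp only [eval_concat]
  refine Measurable.ite (measurableSet_eq_fun ((measurable_eval _).comp measurable_snd)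
    ((measurable_eval _).comp measurable_fst)) ?_ ((measurable_eval _).comp measurable_fst)
  exact Measurable.ite (.const _) ((measurable_eval _).comp measurable_fst)
    ((measurable_eval _).comp measurable_snd)

end Concat

/-- A countable algebra generating the σ-algebra reduces equality of two laws to countably many
equations. -/
theorem measurableSet_measure_eq {Z Ω : Type*} [MeasurableSpace Z] [MeasurableSpace Ω]
    [MeasurableSpace.CountablyGenerated Ω] {a b : Z → Measure Ω} (ha : Measurable a)
    (hb : Measurable b) [∀ z, IsProbabilityMeasure (a z)] [∀ z, IsProbabilityMeasure (b z)] :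
    MeasurableSet {z | a z = b z} := by
  set 𝒜 := generateSetAlgebra (MeasurableSpace.countableGeneratingSet Ω) with h𝒜
  have hgen : MeasurableSpace.generateFrom 𝒜 = ‹MeasurableSpace Ω› := by
    rw [h𝒜, generateFrom_generateSetAlgebra_eq, MeasurableSpace.generateFrom_countableGeneratingSet]
  have hpi : IsPiSystem 𝒜 := fun s hs t ht _ =>
    isSetAlgebra_generateSetAlgebra.inter_mem hs ht
  have hmeas : ∀ B ∈ 𝒜, MeasurableSet B := fun B hB => by
    rw [← hgen]; exact MeasurableSpace.measurableSet_generateFrom hB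
  have : {z | a z = b z} = ⋂ B ∈ 𝒜, {z | a z B = b z B} := by
    ext z
    simp only [mem_ofPred_eq, mem_iInter]
    refine ⟨fun h B _ => by rw [h], fun h => ?_⟩
    exact ext_of_generate_finite 𝒜 hgen.symm hpi h (by simp)
  rw [this]
  refine .biInter (countable_generateSetAlgebra
    MeasurableSpace.countable_countableGeneratingSet) fun B hB => ?_
  exact measurableSet_eq_fun ((Measure.measurable_coe (hmeas B hB)).comp ha)
    ((Measure.measurable_coe (hmeas B hB)).comp hb)

/-- The set of points at which a measurable family of laws belongs to a set-valued map with
analytic graph is universally measurable. -/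
theorem nullMeasurableSet_mem_graph {E : Type*} [MetricSpace E] [MeasurableSpace E]
    [BorelSpace E] {Ω : Type*} [TopologicalSpace Ω] [MeasurableSpace Ω]
    [BorelSpace Ω] [HasOuterApproxClosed Ω] [MeasurableSpace.CountablyGenerated Ω]
    {G : E → Set (ProbabilityMeasure Ω)}
    (hG : AnalyticSet {p : E × ProbabilityMeasure Ω | p.2 ∈ G p.1})
    {q : E → ProbabilityMeasure Ω} (hq : Measurable fun x => (q x : Measure Ω))
    (μ : Measure E) [IsFiniteMeasure μ] : NullMeasurableSet {x | q x ∈ G x} μ := by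
  rw [AnalyticSet] at hG
  obtain h0 | ⟨φ, hφ, hr⟩ := hG
  · have : {x | q x ∈ G x} = ∅ := by
      refine eq_empty_iff_forall_notMem.2 fun x hx => ?_
      exact eq_empty_iff_forall_notMem.1 h0 (x, q x) hx
    rw [this]
    exact nullMeasurableSet_empty
  have hfst : Continuous fun z => (φ z).1 := continuous_fst.comp hφ
  have hZ : MeasurableSet {z | ((φ z).2 : Measure Ω) = q (φ z).1} :=
    measurableSet_measure_eq (measurable_measure_of_continuous (continuous_snd.comp hφ))
      (hq.comp hfst.measurable)
  -- The coincidence set of `q` with the parametrized graph is Borel in `ℕ → ℕ`; its projection is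
  -- analytic.
  have hset : {x | q x ∈ G x} = (fun z => (φ z).1) '' {z | ((φ z).2 : Measure Ω) = q (φ z).1} := by
    ext x
    constructor
    · intro hx
      obtain ⟨z, hz⟩ : ((x, q x) : E × ProbabilityMeasure Ω) ∈ range φ := by rw [hr]; exact hx
      exact ⟨z, by simp [hz], by simp [hz]⟩
    · rintro ⟨z, hz, rfl⟩
      have hz' : (φ z).2 = q (φ z).1 := Subtype.ext hz
      have : φ z ∈ {p : E × ProbabilityMeasure Ω | p.2 ∈ G p.1} := hr ▸ mem_range_self z
      simpa [hz'] using this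
  rw [hset]
  exact nullMeasurableSet_of_analyticSet (hZ.analyticSet.image_of_continuous hfst) μ

/-! ### Dependence on the past only -/

section Past

variable {k : PathKind} {E : Type*}

/-- Functions measurable with respect to the past only depend on the past. -/
theorem eq_of_past [TopologicalSpace E] [MeasurableSpace E] {s : I} {g : PathSpace k 1 E → ℝ≥0∞} (hg : Measurable[past s] g)
    {ω η : PathSpace k 1 E} (h : ∀ r ≤ s, ω.eval r = η.eval r) : g ω = g η :=
  ((mem_iff_of_past (hg (measurableSet_singleton (g ω))) h).1 rfl).symm

theorem past_mono [TopologicalSpace E] [MeasurableSpace E] {s t : I} (h : s ≤ t) :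
    (past s : MeasurableSpace (PathSpace k 1 E)) ≤ past t :=
  iSup_le fun r => (measurable_eval_past (r.2.trans h)).comap_le

variable [PseudoMetricSpace E] [MeasurableSpace E] [BorelSpace E]

theorem lintegral_eq_of_past {s : I} {P P' : Measure (PathSpace k 1 E)}
    (hPP' : ∀ F, MeasurableSet[past s] F → P' F = P F) {g : PathSpace k 1 E → ℝ≥0∞}
    (hg : Measurable[past s] g) : ∫⁻ ω, g ω ∂P' = ∫⁻ ω, g ω ∂P := by
  have hle : (past s : MeasurableSpace (PathSpace k 1 E)) ≤ inferInstanceAs _ := past_le s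
  rw [← lintegral_trim hle hg, ← lintegral_trim hle hg]
  congr 1
  refine @Measure.ext _ (past s) _ _ fun F hF => ?_
  rw [trim_measurableSet_eq hle hF, trim_measurableSet_eq hle hF, hPP' F hF]

theorem map_eval_eq_of_past {s r : I} (hr : r ≤ s) {P P' : Measure (PathSpace k 1 E)}
    (hPP' : ∀ F, MeasurableSet[past s] F → P' F = P F) :
    P'.map (PathSpace.eval r) = P.map (PathSpace.eval r) := by
  ext B hB
  rw [Measure.map_apply (PathSpace.measurable_eval r) hB,
    Measure.map_apply (PathSpace.measurable_eval r) hB, hPP' _ (measurable_eval_past hr hB)]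

end Past

variable {k : PathKind} {E : Type*} [MetricSpace E] [SecondCountableTopology E]
  [MeasurableSpace E] [BorelSpace E]

/-- Right continuity recovers every evaluation from those at a countable dense set of times. The end
point `T` is added because it cannot be approached from the right. -/
theorem PathSpace.countablyGenerated {T : ℝ} (hT : 0 < T) :
    MeasurableSpace.CountablyGenerated (PathSpace k T E) := by
  obtain ⟨D, hDc, hDd⟩ := TopologicalSpace.exists_countable_dense (Icc (0 : ℝ) T)
  let D' : Set (Icc (0 : ℝ) T) := insert ⟨T, right_mem_Icc.2 hT.le⟩ D
  have : Countable D' := (hDc.insert _).to_subtype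
  let ρ : PathSpace k T E → D' → E := fun ω q => ω.eval q
  have heq : (borel (PathSpace k T E)) = MeasurableSpace.comap ρ MeasurableSpace.pi := by
    refine le_antisymm ?_ ?_
    · let m : MeasurableSpace (PathSpace k T E) := MeasurableSpace.comap ρ MeasurableSpace.pi
      have hD : ∀ q ∈ D', Measurable[m] fun ω : PathSpace k T E => ω.eval q := fun q hq =>
        (measurable_pi_apply (X := fun _ : D' => E) ⟨q, hq⟩).comp (comap_measurable ρ)
      suffices hall : ∀ t, Measurable[m] fun ω : PathSpace k T E => ω.eval t by
        have hid := @PathSpace.measurable_of_eval k T E _ _ _ _ hT (PathSpace k T E) m id hall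
        exact fun s hs => hid hs
      intro t
      rcases eq_or_lt_of_le t.2.2 with htT | htT
      · have : t = ⟨T, right_mem_Icc.2 hT.le⟩ := Subtype.ext htT
        exact hD t (this ▸ mem_insert _ _)
      have hne : (comap (Subtype.val : D' → Icc (0 : ℝ) T) (𝓝[>] t)).NeBot := by
        refine comap_neBot_iff.2 fun s hs => ?_
        obtain ⟨O, hO, htO, hOs⟩ := mem_nhdsWithin.1 hs
        have hcl : t ∈ closure (Ioi t) := by
          refine Metric.mem_closure_iff.2 fun ε hε => ?_
          have h1 : (t : ℝ) < min T (t + ε / 2) := lt_min htT (by linarith)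
          refine ⟨⟨min T (t + ε / 2), t.2.1.trans h1.le, min_le_left _ _⟩,
            show (t : ℝ) < min T (t + ε / 2) from h1, ?_⟩
          rw [dist_comm, Subtype.dist_eq, Real.dist_eq, abs_of_pos (by simpa using h1)]
          have := min_le_right T (t + ε / 2)
          simp only
          linarith
        obtain ⟨q, hq, hqD⟩ := hDd.inter_open_nonempty _ (hO.inter isOpen_Ioi)
          (mem_closure_iff.1 hcl O hO htO)
        exact ⟨⟨q, mem_insert_of_mem _ hqD⟩, hOs hq⟩
      refine @measurable_of_tendsto_metrizable' _ _ m _ _ _ _ _ (fun (q : D') ω => ω.eval (q : Icc (0 : ℝ) T))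
        _ (comap (Subtype.val : D' → Icc (0 : ℝ) T) (𝓝[>] t)) _ _ (fun q => hD q q.2) ?_
      refine tendsto_pi_nhds.2 fun ω => ?_
      exact ((ω.rightCont t).mono_left (nhdsWithin_mono _ Ioi_subset_Ici_self)).comp tendsto_comap
    · exact Measurable.comap_le (measurable_pi_lambda _ fun q => PathSpace.measurable_eval _)
  have : MeasurableSpace.CountablyGenerated (D' → E) := inferInstance
  have hc := MeasurableSpace.CountablyGenerated.comap ρ
  rw [← heq] at hc
  exact hc

theorem measurable_segment_past {s t : I} (hst : s < t) :
    Measurable[past t] (PathSpace.segment s t : PathSpace k 1 E → _) := by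
  let _ : MeasurableSpace (PathSpace k 1 E) := past t
  refine PathSpace.measurable_of_eval (sub_pos.2 hst) fun r => ?_
  simp only [PathSpace.eval_segment]
  refine measurable_eval_past (Subtype.coe_le_coe.1 ?_)
  have := r.2.2
  simp only [shiftTime]
  linarith

/-- Whether the conditional law given the initial position is admissible only depends on the law of
the path up to the time considered. -/
theorem mem_constraintSet_of_past {t : I} (ht : 0 < t)
    {G : E → Set (ProbabilityMeasure (PathSpace k ((t : ℝ) - (0 : I)) E))}
    (hG : AnalyticSet {p : E × ProbabilityMeasure (PathSpace k ((t : ℝ) - (0 : I)) E) |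
      p.2 ∈ G p.1})
    {P P' : ProbabilityMeasure (PathSpace k 1 E)}
    (hPP' : ∀ F, MeasurableSet[past t] F →
      (P' : Measure (PathSpace k 1 E)) F = (P : Measure (PathSpace k 1 E)) F)
    (hP : P ∈ constraintSet 0 t G) : P' ∈ constraintSet 0 t G := by
  obtain ⟨κ, hκ, hae⟩ := hP
  have hmono : (past (0 : I) : MeasurableSpace (PathSpace k 1 E)) ≤ past t := past_mono ht.le
  refine ⟨κ, ⟨hκ.measurable, fun B hB F hF => ?_⟩, ?_⟩
  · have hF' := past_le _ _ hF
    rw [← lintegral_indicator hF', lintegral_eq_of_past hPP' (g := F.indicator fun ω =>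
      (κ ω : Measure (PathSpace k ((t : ℝ) - (0 : I)) E)) B) (Measurable.indicator
        ((hκ.measurable B hB).mono hmono le_rfl) (hmono _ hF)), lintegral_indicator hF',
      hκ.setLIntegral_eq B hB F hF, hPP' _ ((hmono _ hF).inter (measurable_segment_past ht hB))]
  -- Being measurable with respect to the past of time `0`, the kernel is a function of the initial
  -- position, which can be read off on constant paths.
  · let q : E → ProbabilityMeasure (PathSpace k ((t : ℝ) - (0 : I)) E) := fun x =>
      κ (PathSpace.const k 1 x)
    have hκq : ∀ ω, κ ω = q (ω.eval 0) := by
      intro ω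
      refine Subtype.ext (Measure.ext fun B hB => eq_of_past (hκ.measurable B hB) fun r hr => ?_)
      obtain rfl : r = 0 := le_antisymm hr bot_le
      simp
    have hq : Measurable fun x => (q x : Measure (PathSpace k ((t : ℝ) - (0 : I)) E)) := by
      refine Measure.measurable_of_measurable_coe _ fun B hB => ?_
      exact ((hκ.measurable B hB).mono (past_le _) le_rfl).comp (PathSpace.measurable_const one_pos)
    have := PathSpace.countablyGenerated (k := k) (E := E) (T := (t : ℝ) - (0 : I)) (sub_pos.2 ht)
    -- The exceptional set of paths need not be measurable, so its nullity does not pass directly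
    -- from `P` to `P'`. Null measurability of the good initial positions turns it into a statement
    -- on the initial law, which both share.
    have hnull := nullMeasurableSet_mem_graph hG hq
      ((P : Measure (PathSpace k 1 E)).map (PathSpace.eval 0))
    have h1 : ∀ᵐ x ∂(P : Measure (PathSpace k 1 E)).map (PathSpace.eval 0), q x ∈ G x := by
      have h2 := Measure.map_apply₀ (PathSpace.measurable_eval 0).aemeasurable hnull.compl
      refine h2.trans (measure_mono_null (fun ω hω => ?_) hae)
      simpa [hκq] using hω
    rw [← map_eval_eq_of_past (show (0 : I) ≤ t from ht.le) hPP'] at h1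
    filter_upwards [ae_of_ae_map (PathSpace.measurable_eval 0).aemeasurable h1] with ω hω
    rw [hκq]
    exact hω

open ProbabilityTheory

theorem concat_mem_iff {k : PathKind} {E : Type*} [TopologicalSpace E] [MeasurableSpace E]
    {s t : I} (hst : s < t) {F : Set (PathSpace k 1 E)} (hF : MeasurableSet[past s] F)
    (ω : PathSpace k 1 E) (η : PathSpace k ((t : ℝ) - s) E) : ω.concat hst η ∈ F ↔ ω ∈ F :=
  mem_iff_of_past hF fun _ hr => PathSpace.eval_concat_of_le hst ω η hr

theorem measurable_integral_law {Z Ω : Type*} [MeasurableSpace Z] [TopologicalSpace Ω]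
    [MeasurableSpace Ω] [BorelSpace Ω] {Q : Z → ProbabilityMeasure Ω}
    (hQ : Measurable fun x => (Q x : Measure Ω)) (f : Ω →ᵇ ℝ) :
    Measurable fun x => ∫ η, f η ∂(Q x : Measure Ω) := by
  let κ : Kernel Z Ω := ⟨fun x => Q x, hQ⟩
  have : IsMarkovKernel κ := ⟨fun x => inferInstanceAs (IsProbabilityMeasure (Q x : Measure Ω))⟩
  exact ((f.continuous.measurable.stronglyMeasurable.comp_measurable
    measurable_snd).integral_kernel_prod_right' (κ := κ)
      (f := fun p : Z × Ω => f p.2)).measurable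

/-! ### Gluing a law with a kernel of continuations -/

section Glue

variable {k : PathKind} {E : Type*} [MetricSpace E] [SecondCountableTopology E]
  [MeasurableSpace E] [BorelSpace E] {s t : I}

/-- The kernel that picks a path on `[0, t - s]` according to the position at time `s`. -/
noncomputable def continuationKernel {Q : E → ProbabilityMeasure (PathSpace k ((t : ℝ) - s) E)}
    (hQ : Measurable fun x => (Q x : Measure (PathSpace k ((t : ℝ) - s) E))) :
    Kernel (PathSpace k 1 E) (PathSpace k ((t : ℝ) - s) E) where
  toFun ω := Q (ω.eval s)
  measurable' := hQ.comp (PathSpace.measurable_eval s)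

instance {Q : E → ProbabilityMeasure (PathSpace k ((t : ℝ) - s) E)}
    (hQ : Measurable fun x => (Q x : Measure (PathSpace k ((t : ℝ) - s) E))) :
    IsMarkovKernel (continuationKernel hQ) :=
  ⟨fun ω => inferInstanceAs
    (IsProbabilityMeasure (Q (ω.eval s) : Measure (PathSpace k ((t : ℝ) - s) E)))⟩

/-- The law that follows `P` up to time `s` and continues, up to time `t`, with the law `Q` of the
position at time `s`. -/
noncomputable def glue (hst : s < t) (P : ProbabilityMeasure (PathSpace k 1 E))
    {Q : E → ProbabilityMeasure (PathSpace k ((t : ℝ) - s) E)}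
    (hQ : Measurable fun x => (Q x : Measure (PathSpace k ((t : ℝ) - s) E))) :
    ProbabilityMeasure (PathSpace k 1 E) :=
  ⟨((P : Measure (PathSpace k 1 E)) ⊗ₘ continuationKernel hQ).map fun p => p.1.concat hst p.2,
    Measure.isProbabilityMeasure_map (PathSpace.measurable_concat hst).aemeasurable⟩

variable (hst : s < t) (P : ProbabilityMeasure (PathSpace k 1 E))
  {Q : E → ProbabilityMeasure (PathSpace k ((t : ℝ) - s) E)}
  (hQ : Measurable fun x => (Q x : Measure (PathSpace k ((t : ℝ) - s) E)))

theorem coe_glue : (glue hst P hQ : Measure (PathSpace k 1 E)) =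
    ((P : Measure (PathSpace k 1 E)) ⊗ₘ continuationKernel hQ).map fun p => p.1.concat hst p.2 :=
  rfl

theorem glue_apply_of_past {F : Set (PathSpace k 1 E)} (hF : MeasurableSet[past s] F) :
    (glue hst P hQ : Measure (PathSpace k 1 E)) F = (P : Measure (PathSpace k 1 E)) F := by
  have hF' : MeasurableSet F := past_le _ _ hF
  rw [coe_glue, Measure.map_apply (PathSpace.measurable_concat hst) hF']
  have : (fun p : PathSpace k 1 E × PathSpace k ((t : ℝ) - s) E => p.1.concat hst p.2) ⁻¹' F =
      Prod.fst ⁻¹' F := by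
    ext p; exact concat_mem_iff hst hF p.1 p.2
  rw [this, ← Measure.map_apply measurable_fst hF']
  change (Measure.fst _) F = _
  rw [Measure.fst_compProd]

theorem ae_segment_concat
    (hstart : ∀ᵐ ω ∂(P : Measure (PathSpace k 1 E)),
      ∀ᵐ η ∂(Q (ω.eval s) : Measure (PathSpace k ((t : ℝ) - s) E)),
        η.start (sub_nonneg_of_lt hst) = ω.eval s) :
    ∀ᵐ p ∂((P : Measure (PathSpace k 1 E)) ⊗ₘ continuationKernel hQ),
      (p.1.concat hst p.2).segment s t = p.2 := by
  have hm : MeasurableSet {p : PathSpace k 1 E × PathSpace k ((t : ℝ) - s) E |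
      p.2.start (sub_nonneg_of_lt hst) = p.1.eval s} :=
    measurableSet_eq_fun ((PathSpace.measurable_eval _).comp measurable_snd)
      ((PathSpace.measurable_eval _).comp measurable_fst)
  filter_upwards [Measure.ae_compProd_of_ae_ae hm hstart] with p hp
  exact PathSpace.segment_concat hst p.1 p.2 hp

theorem isCondLawGivenPast_glue
    (hstart : ∀ᵐ ω ∂(P : Measure (PathSpace k 1 E)),
      ∀ᵐ η ∂(Q (ω.eval s) : Measure (PathSpace k ((t : ℝ) - s) E)),
        η.start (sub_nonneg_of_lt hst) = ω.eval s) :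
    IsCondLawGivenPast (glue hst P hQ) s t fun ω => Q (ω.eval s) where
  measurable B hB := ((Measure.measurable_coe hB).comp hQ).comp (measurable_eval_past le_rfl)
  setLIntegral_eq B hB F hF := by
    have hF' : MeasurableSet F := past_le _ _ hF
    have hg : Measurable[past s] fun ω : PathSpace k 1 E =>
        (Q (ω.eval s) : Measure (PathSpace k ((t : ℝ) - s) E)) B :=
      ((Measure.measurable_coe hB).comp hQ).comp (measurable_eval_past le_rfl)
    rw [← lintegral_indicator hF', lintegral_eq_of_past (s := s)
      (fun F hF => glue_apply_of_past hst P hQ hF) (hg.indicator hF), lintegral_indicator hF',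
      coe_glue, Measure.map_apply (PathSpace.measurable_concat hst)
        (hF'.inter (PathSpace.measurable_segment hst hB))]
    -- Almost surely the continuation starts in the right place, so the segment of the glued path is
    -- the continuation itself and the event becomes a rectangle.
    have hset : (fun p : PathSpace k 1 E × PathSpace k ((t : ℝ) - s) E => p.1.concat hst p.2) ⁻¹'
        (F ∩ PathSpace.segment s t ⁻¹' B) =ᵐ[(P : Measure (PathSpace k 1 E)) ⊗ₘ
          continuationKernel hQ] F ×ˢ B := by
      refine Filter.eventuallyEq_set.2 ?_
      filter_upwards [ae_segment_concat hst P hQ hstart] with p hp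
      rw [mem_preimage, mem_inter_iff, mem_preimage, hp, concat_mem_iff hst hF, mem_prod]
    rw [measure_congr hset, Measure.compProd_apply_prod hF' hB]
    rfl

theorem integral_segment_glue
    (hstart : ∀ᵐ ω ∂(P : Measure (PathSpace k 1 E)),
      ∀ᵐ η ∂(Q (ω.eval s) : Measure (PathSpace k ((t : ℝ) - s) E)),
        η.start (sub_nonneg_of_lt hst) = ω.eval s)
    (f : PathSpace k ((t : ℝ) - s) E →ᵇ ℝ) :
    ∫ ω, f (ω.segment s t) ∂(glue hst P hQ : Measure (PathSpace k 1 E)) =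
      ∫ x, ∫ η, f η ∂(Q x : Measure (PathSpace k ((t : ℝ) - s) E))
        ∂((P : Measure (PathSpace k 1 E)).map (PathSpace.eval s)) := by
  have hf : Measurable fun ω : PathSpace k 1 E => f (ω.segment s t) :=
    f.continuous.measurable.comp (PathSpace.measurable_segment hst)
  rw [coe_glue, integral_map (PathSpace.measurable_concat hst).aemeasurable
    hf.aestronglyMeasurable]
  have h1 : ∫ p, f ((p.1.concat hst p.2).segment s t)
      ∂((P : Measure (PathSpace k 1 E)) ⊗ₘ continuationKernel hQ) =
      ∫ p, f p.2 ∂((P : Measure (PathSpace k 1 E)) ⊗ₘ continuationKernel hQ) := by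
    refine integral_congr_ae ?_
    filter_upwards [ae_segment_concat hst P hQ hstart] with p hp
    rw [hp]
  have hint : Integrable (fun p : PathSpace k 1 E × PathSpace k ((t : ℝ) - s) E => f p.2)
      ((P : Measure (PathSpace k 1 E)) ⊗ₘ continuationKernel hQ) :=
    Integrable.of_bound (f.continuous.measurable.comp measurable_snd).aestronglyMeasurable ‖f‖
      (ae_of_all _ fun p => f.norm_coe_le_norm p.2)
  rw [h1, Measure.integral_compProd hint, integral_map (PathSpace.measurable_eval s).aemeasurable]
  · rfl
  · exact (measurable_integral_law hQ f).aestronglyMeasurable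

end Glue

/-- The inequality for `-f` is the reverse one, and bounded Lipschitz functions determine a law. -/
theorem measure_eq_of_forall_integral_le {E : Type*} [PseudoMetricSpace E] [MeasurableSpace E]
    [BorelSpace E] {μ ν : Measure E} [IsProbabilityMeasure μ] [IsProbabilityMeasure ν]
    (h : ∀ (f : E →ᵇ ℝ) (L : ℝ≥0), LipschitzWith L f → ∫ x, f x ∂μ ≤ ∫ x, f x ∂ν) : μ = ν := by
  have heq : ∀ (f : E →ᵇ ℝ) (L : ℝ≥0), LipschitzWith L f → ∫ x, f x ∂μ = ∫ x, f x ∂ν := by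
    intro f L hL
    refine le_antisymm (h f L hL) ?_
    have := h (-f) L hL.neg
    simp only [BoundedContinuousFunction.coe_neg, Pi.neg_apply, integral_neg] at this
    linarith
  let μ' : ProbabilityMeasure E := ⟨μ, inferInstance⟩
  let ν' : ProbabilityMeasure E := ⟨ν, inferInstance⟩
  have ht : Tendsto (fun _ : ℕ => μ') atTop (𝓝 ν') := by
    rw [tendsto_iff_forall_lipschitz_integral_tendsto]
    rintro f ⟨C, hC⟩ ⟨L, hL⟩
    let g : E →ᵇ ℝ := ⟨⟨f, hL.continuous⟩, C, hC⟩
    exact tendsto_const_nhds.congr fun _ => (heq g L hL).symm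
  have hfin : ∀ f : E →ᵇ ℝ, ∫ x, f x ∂μ = ∫ x, f x ∂ν := fun f =>
    tendsto_nhds_unique tendsto_const_nhds
      (ProbabilityMeasure.tendsto_iff_forall_integral_tendsto.1 ht f)
  exact ext_of_forall_integral_eq_of_IsFiniteMeasure hfin

/-! ### Final-time test functions and almost optimal continuations -/

section

variable {k : PathKind} {E : Type*}

theorem shiftTime_zero {t u : I} {r : Icc (0 : ℝ) ((t : ℝ) - (0 : I))} (hr : (r : ℝ) = u) :
    shiftTime 0 t r = u :=
  Subtype.ext (by simp [shiftTime, hr])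

@[simp]
theorem PathSpace.final_segment [TopologicalSpace E] {s t : I} (hst : s < t)
    (ω : PathSpace k 1 E) : (ω.segment s t).final (sub_nonneg_of_lt hst) = ω.eval t := by
  rw [final, eval_segment]
  congr 1
  exact Subtype.ext (by simp [shiftTime])

/-- The final value of a bounded continuous function. -/
noncomputable def finalBCF (k : PathKind) [PseudoMetricSpace E] {T : ℝ} (hT : 0 ≤ T) (f : E →ᵇ ℝ) :
    PathSpace k T E →ᵇ ℝ :=
  f.compContinuous ⟨PathSpace.final hT, PathSpace.continuous_final hT⟩

theorem finalBCF_segment [PseudoMetricSpace E] {s t : I} (hst : s < t) (f : E →ᵇ ℝ)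
    (ω : PathSpace k 1 E) : finalBCF k (sub_nonneg_of_lt hst) f (ω.segment s t) = f (ω.eval t) := by
  change f ((ω.segment s t).final (sub_nonneg_of_lt hst)) = _
  rw [PathSpace.final_segment hst]

theorem penalizedSup_segment_mono [PseudoMetricSpace E] (f : E →ᵇ ℝ) {m : ℝ} (hm : 0 ≤ m) (u : ℝ)
    {t t' : I} (htt' : t ≤ t') (ω : PathSpace k 1 E) :
    penalizedSup f m u (ω.segment 0 t) ≤ penalizedSup f m u (ω.segment 0 t') := by
  have : Nonempty (Icc (0 : ℝ) ((t : ℝ) - (0 : I))) := ⟨⟨0, by simpa using t.2.1⟩⟩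
  refine ciSup_le fun r => ?_
  have h1 := le_penalizedSup f hm u (ω.segment 0 t')
    ⟨r, r.2.1, r.2.2.trans (sub_le_sub_right (Subtype.coe_le_coe.2 htt') _)⟩
  rw [PathSpace.eval_segment] at h1 ⊢
  exact h1

variable [MetricSpace E]

theorem lowerExpectation_bounds {T : ℝ} (hT : 0 ≤ T)
    {G : E → Set (ProbabilityMeasure (PathSpace k T E))} (hne : ∀ x, (G x).Nonempty) (f : E →ᵇ ℝ)
    (x : E) : |lowerExpectation hT G f x| ≤ ‖f‖ := by
  have : Nonempty (G x) := (hne x).to_subtype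
  have hb : ∀ Q : ProbabilityMeasure (PathSpace k T E),
      |∫ ω, f (ω.final hT) ∂(Q : Measure (PathSpace k T E))| ≤ ‖f‖ := fun Q => by
    have := norm_integral_le_of_norm_le_const (μ := (Q : Measure (PathSpace k T E)))
      (ae_of_all _ fun ω : PathSpace k T E => f.norm_coe_le_norm (ω.final hT))
    simpa using this
  refine abs_le.2 ⟨le_ciInf fun Q => (abs_le.1 (hb Q)).1, ?_⟩
  obtain ⟨Q⟩ := this
  exact (ciInf_le ⟨-‖f‖, by rintro _ ⟨Q, rfl⟩; exact (abs_le.1 (hb Q)).1⟩ Q).trans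
    (abs_le.1 (hb Q)).2

theorem continuous_integral_final {T : ℝ} (hT : 0 ≤ T) (f : E →ᵇ ℝ) :
    Continuous fun Q : ProbabilityMeasure (PathSpace k T E) =>
      ∫ ω, f (ω.final hT) ∂(Q : Measure (PathSpace k T E)) :=
  ProbabilityMeasure.continuous_integral_boundedContinuousFunction (finalBCF k hT f)

theorem bddBelow_integral_final {T : ℝ} (hT : 0 ≤ T) (f : E →ᵇ ℝ) :
    BddBelow (range fun Q : ProbabilityMeasure (PathSpace k T E) =>
      ∫ ω, f (ω.final hT) ∂(Q : Measure (PathSpace k T E))) := by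
  refine ⟨-‖f‖, ?_⟩
  rintro _ ⟨Q, rfl⟩
  have := norm_integral_le_of_norm_le_const (μ := (Q : Measure (PathSpace k T E)))
    (ae_of_all _ fun ω : PathSpace k T E => f.norm_coe_le_norm (ω.final hT))
  exact (abs_le.1 (by simpa using this)).1

variable [MeasurableSpace E] [BorelSpace E]

theorem integrable_eval (P : ProbabilityMeasure (PathSpace k 1 E)) (f : E →ᵇ ℝ) (t : I) :
    Integrable (fun ω : PathSpace k 1 E => f (ω.eval t)) (P : Measure (PathSpace k 1 E)) :=
  Integrable.of_bound
    (f.continuous.measurable.comp (PathSpace.measurable_eval t)).aestronglyMeasurable ‖f‖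
    (ae_of_all _ fun _ => f.norm_coe_le_norm _)

theorem integral_eval {P : ProbabilityMeasure (PathSpace k 1 E)} {t : I} {μ : ProbabilityMeasure E}
    (hP : P ∈ marginalSet k t μ) (f : E →ᵇ ℝ) :
    ∫ ω, f (ω.eval t) ∂(P : Measure (PathSpace k 1 E)) = ∫ x, f x ∂(μ : Measure E) := by
  have hP' : (P : Measure (PathSpace k 1 E)).map (PathSpace.eval t) = μ := hP
  rw [← hP', integral_map (PathSpace.measurable_eval t).aemeasurable
    f.continuous.measurable.aestronglyMeasurable]

theorem integrable_lowerExpectation {T : ℝ} (hT : 0 ≤ T)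
    {G : E → Set (ProbabilityMeasure (PathSpace k T E))} (hne : ∀ x, (G x).Nonempty)
    (hG : AnalyticSet {p : E × ProbabilityMeasure (PathSpace k T E) | p.2 ∈ G p.1}) (f : E →ᵇ ℝ)
    (μ : Measure E) [IsFiniteMeasure μ] : Integrable (lowerExpectation hT G f) μ :=
  Integrable.of_bound (aemeasurable_iInf_section hG (continuous_integral_final hT f)
    (bddBelow_integral_final hT f) hne μ).aestronglyMeasurable ‖f‖
    (ae_of_all _ fun x => lowerExpectation_bounds hT hne f x)

theorem mem_marginalSet_of_forall_integral_le {P : ProbabilityMeasure (PathSpace k 1 E)} {t : I}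
    {μ : ProbabilityMeasure E} (h : ∀ (f : E →ᵇ ℝ) (L : ℝ≥0), LipschitzWith L f →
      ∫ x, f x ∂(μ : Measure E) ≤ ∫ ω, f (ω.eval t) ∂(P : Measure (PathSpace k 1 E))) :
    P ∈ marginalSet k t μ := by
  have := Measure.isProbabilityMeasure_map (μ := (P : Measure (PathSpace k 1 E)))
    (PathSpace.measurable_eval (E := E) (k := k) t).aemeasurable
  refine (measure_eq_of_forall_integral_le fun f L hL => ?_).symm
  rw [integral_map (PathSpace.measurable_eval t).aemeasurable
    f.continuous.measurable.aestronglyMeasurable]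
  exact h f L hL

variable [SecondCountableTopology E]

/-- A law can be continued, admissibly, such that the final expectation of `f` is almost as small as
possible. -/
theorem exists_continuation {s t : I} (hst : s < t)
    {G : E → Set (ProbabilityMeasure (PathSpace k ((t : ℝ) - s) E))}
    (hne : ∀ x, (G x).Nonempty)
    (hstart : ∀ x, ∀ Q ∈ G x, ∀ᵐ ω ∂(Q : Measure (PathSpace k ((t : ℝ) - s) E)),
      ω.start (sub_nonneg_of_lt hst) = x)
    (hG : AnalyticSet {p : E × ProbabilityMeasure (PathSpace k ((t : ℝ) - s) E) | p.2 ∈ G p.1})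
    {μ : ProbabilityMeasure E} {P : ProbabilityMeasure (PathSpace k 1 E)}
    (hP : P ∈ marginalSet k s μ) (f : E →ᵇ ℝ) {ε : ℝ} (hε : 0 < ε) :
    ∃ P' ∈ constraintSet s t G, (∀ F, MeasurableSet[past s] F →
        (P' : Measure (PathSpace k 1 E)) F = (P : Measure (PathSpace k 1 E)) F) ∧
      ∫ ω, f (ω.eval t) ∂(P' : Measure (PathSpace k 1 E)) ≤
        ∫ x, lowerExpectation (sub_nonneg_of_lt hst) G f x ∂(μ : Measure E) + ε := by
  have hT := sub_nonneg_of_lt hst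
  have hP' : (P : Measure (PathSpace k 1 E)).map (PathSpace.eval s) = μ := hP
  have : Nonempty E := nonempty_of_isProbabilityMeasure (μ : Measure E)
  -- The selection passes through `ℕ → ℕ`, so its measurability as a family of measures follows from
  -- that of `z` and continuity of `c`.
  obtain ⟨z, c, hz, hc, hae⟩ := exists_measurable_almost_optimal hG
    (continuous_integral_final hT f) (bddBelow_integral_final hT f) hne (μ : Measure E) hε
  let Q : E → ProbabilityMeasure (PathSpace k ((t : ℝ) - s) E) := fun x => c (z x)
  have hQ : Measurable fun x => (Q x : Measure (PathSpace k ((t : ℝ) - s) E)) :=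
    (measurable_measure_of_continuous hc).comp hz
  have haeP : ∀ᵐ ω ∂(P : Measure (PathSpace k 1 E)), Q (ω.eval s) ∈ G (ω.eval s) := by
    rw [← hP'] at hae
    filter_upwards [ae_of_ae_map (PathSpace.measurable_eval s).aemeasurable hae] with ω hω
    exact hω.1
  have hst' : ∀ᵐ ω ∂(P : Measure (PathSpace k 1 E)),
      ∀ᵐ η ∂(Q (ω.eval s) : Measure (PathSpace k ((t : ℝ) - s) E)),
        η.start (sub_nonneg_of_lt hst) = ω.eval s := by
    filter_upwards [haeP] with ω hω
    exact hstart _ _ hω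
  have hpast : ∀ F, MeasurableSet[past s] F →
      (glue hst P hQ : Measure (PathSpace k 1 E)) F = (P : Measure (PathSpace k 1 E)) F :=
    fun F hF => glue_apply_of_past hst P hQ hF
  refine ⟨glue hst P hQ, ⟨_, isCondLawGivenPast_glue hst P hQ hst', ?_⟩, hpast, ?_⟩
  · rw [← hP', ← map_eval_eq_of_past le_rfl hpast] at hae
    filter_upwards [ae_of_ae_map (PathSpace.measurable_eval s).aemeasurable hae] with ω hω
    exact hω.1
  · have h1 := integral_segment_glue hst P hQ hst' (finalBCF k hT f)
    simp only [finalBCF_segment hst, hP'] at h1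
    have hint := integrable_lowerExpectation hT hne hG f (μ : Measure E)
    have h2 : ∫ x, (lowerExpectation hT G f x + ε) ∂(μ : Measure E) =
        ∫ x, lowerExpectation hT G f x ∂(μ : Measure E) + ε := by
      rw [integral_add hint (integrable_const ε)]
      simp
    rw [h1, ← h2]
    refine integral_mono_ae ?_ (hint.add (integrable_const ε)) (hae.mono fun x hx => hx.2.le)
    refine Integrable.of_bound (measurable_integral_law hQ _).aestronglyMeasurable
      ‖finalBCF k hT f‖ (ae_of_all _ fun x => ?_)
    have := norm_integral_le_of_norm_le_const
      (μ := (Q x : Measure (PathSpace k ((t : ℝ) - s) E)))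
      (ae_of_all _ fun ω : PathSpace k ((t : ℝ) - s) E => (finalBCF k hT f).norm_coe_le_norm ω)
    simpa using this

end

/-! ### Extension to a prescribed later marginal -/

section

variable {k : PathKind} {E : Type*} [MetricSpace E] [MeasurableSpace E] [BorelSpace E]
  [SecondCountableTopology E]

/-- The law of a segment. -/
noncomputable def segmentLaw {s t : I} (hst : s < t) (P : ProbabilityMeasure (PathSpace k 1 E)) :
    ProbabilityMeasure (PathSpace k ((t : ℝ) - s) E) :=
  ⟨(P : Measure (PathSpace k 1 E)).map (PathSpace.segment s t),
    Measure.isProbabilityMeasure_map (PathSpace.measurable_segment hst).aemeasurable⟩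

theorem integral_map_segment {s t : I} (hst : s < t) (P : Measure (PathSpace k 1 E))
    (g : PathSpace k ((t : ℝ) - s) E →ᵇ ℝ) :
    ∫ η, g η ∂(P.map (PathSpace.segment s t)) = ∫ ω, g (ω.segment s t) ∂P :=
  integral_map (PathSpace.measurable_segment hst).aemeasurable
    g.continuous.measurable.aestronglyMeasurable

theorem integrable_segment {s t : I} (hst : s < t) (P : ProbabilityMeasure (PathSpace k 1 E))
    (g : PathSpace k ((t : ℝ) - s) E →ᵇ ℝ) :
    Integrable (fun ω : PathSpace k 1 E => g (ω.segment s t)) (P : Measure (PathSpace k 1 E)) :=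
  Integrable.of_bound
    (g.continuous.measurable.comp (PathSpace.measurable_segment hst)).aestronglyMeasurable ‖g‖
    (ae_of_all _ fun _ => g.norm_coe_le_norm _)

theorem integral_segment_eq_of_past {s t : I} (hst : s < t)
    {P P' : ProbabilityMeasure (PathSpace k 1 E)}
    (hPP' : ∀ F, MeasurableSet[past t] F →
      (P' : Measure (PathSpace k 1 E)) F = (P : Measure (PathSpace k 1 E)) F)
    (g : PathSpace k ((t : ℝ) - s) E →ᵇ ℝ) :
    ∫ ω, g (ω.segment s t) ∂(P' : Measure (PathSpace k 1 E)) =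
      ∫ ω, g (ω.segment s t) ∂(P : Measure (PathSpace k 1 E)) := by
  rw [← integral_map_segment hst, ← integral_map_segment hst]
  congr 1
  ext B hB
  rw [Measure.map_apply (PathSpace.measurable_segment hst) hB,
    Measure.map_apply (PathSpace.measurable_segment hst) hB, hPP' _ (measurable_segment_past hst hB)]

/-- Continuation of a law from time `s` to time `t` with the right marginal at time `t`. The
expectations of functionals that are controlled by the past of time `s` remain controlled. -/
theorem exists_extension {α : I → ProbabilityMeasure E} {s t : I} (hst : s < t)
    {G : E → Set (ProbabilityMeasure (PathSpace k ((t : ℝ) - s) E))}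
    (hne : ∀ x, (G x).Nonempty)
    (hstart : ∀ x, ∀ Q ∈ G x, ∀ᵐ ω ∂(Q : Measure (PathSpace k ((t : ℝ) - s) E)),
      ω.start (sub_nonneg_of_lt hst) = x)
    (hG : AnalyticSet {p : E × ProbabilityMeasure (PathSpace k ((t : ℝ) - s) E) | p.2 ∈ G p.1})
    {C : Set (ProbabilityMeasure (PathSpace k 1 E))}
    (hconv : Convex ℝ≥0 (ProbabilityMeasure.toMeasure ''
      segmentLaws 0 t (marginalSet k 0 (α 0) ∩ C)))
    (hcomp : IsCompact (segmentLaws 0 t (marginalSet k 0 (α 0) ∩ C)))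
    (hineq : ∀ f : E →ᵇ ℝ, ∫ x, lowerExpectation (sub_nonneg_of_lt hst) G f x ∂(α s : Measure E) ≤
      ∫ x, f x ∂(α t : Measure E))
    {P : ProbabilityMeasure (PathSpace k 1 E)} (hP0 : P ∈ marginalSet k 0 (α 0))
    (hPs : P ∈ marginalSet k s (α s))
    (hC : ∀ P' : ProbabilityMeasure (PathSpace k 1 E), (∀ F, MeasurableSet[past s] F →
        (P' : Measure (PathSpace k 1 E)) F = (P : Measure (PathSpace k 1 E)) F) →
      P' ∈ constraintSet s t G → P' ∈ C)
    {J : Type*} (g : J → PathSpace k ((t : ℝ) - (0 : I)) E →ᵇ ℝ) (c : J → ℝ)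
    (hg : ∀ (j : J) (P' : ProbabilityMeasure (PathSpace k 1 E)), (∀ F, MeasurableSet[past s] F →
        (P' : Measure (PathSpace k 1 E)) F = (P : Measure (PathSpace k 1 E)) F) →
      c j ≤ ∫ ω, g j (ω.segment 0 t) ∂(P' : Measure (PathSpace k 1 E))) :
    ∃ P' ∈ marginalSet k 0 (α 0) ∩ C, P' ∈ marginalSet k t (α t) ∧
      ∀ j, c j ≤ ∫ ω, g j (ω.segment 0 t) ∂(P' : Measure (PathSpace k 1 E)) := by
  have h0t : (0 : I) < t := lt_of_le_of_lt bot_le hst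
  obtain ⟨R, ⟨P', hP', hR⟩, hRj⟩ := exists_forall_le_integral hcomp hconv (J := (E →ᵇ ℝ) ⊕ J)
    (Sum.elim (fun f => finalBCF k (sub_nonneg_of_lt h0t) f) g)
    (Sum.elim (fun f => ∫ x, f x ∂(α t : Measure E)) c) (by
    intro A w hw ε hε
    -- Only the final-time tests enter the function to be optimized. The bounds from `g` hold for
    -- every law with the past of `P`, whatever the continuation.
    let h : (E →ᵇ ℝ) ⊕ J → E →ᵇ ℝ := fun j => Sum.elim (fun f => w j • f) (fun _ => 0) j
    obtain ⟨P', hP'C, hpast, hle⟩ := exists_continuation hst hne hstart hG hPs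
      (-∑ j ∈ A, h j) hε
    have hle' := hle.trans (add_le_add_left (hineq _) ε)
    have hneg : ∀ μ : Measure E, ∫ x, (-∑ j ∈ A, h j) x ∂μ = -∫ x, (∑ j ∈ A, h j) x ∂μ :=
      fun μ => by rw [← integral_neg]; rfl
    have hneg' : ∫ ω, (-∑ j ∈ A, h j) (ω.eval t) ∂(P' : Measure (PathSpace k 1 E)) =
        -∫ ω, (∑ j ∈ A, h j) (ω.eval t) ∂(P' : Measure (PathSpace k 1 E)) := by
      rw [← integral_neg]; rfl
    rw [hneg, hneg'] at hle'
    have hs1 : ∫ x, (∑ j ∈ A, h j) x ∂(α t : Measure E) =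
        ∑ j ∈ A, ∫ x, h j x ∂(α t : Measure E) := by
      rw [← integral_finsetSum _ fun j _ => (h j).integrable _]
      simp
    have hs2 : ∫ ω, (∑ j ∈ A, h j) (ω.eval t) ∂(P' : Measure (PathSpace k 1 E)) =
        ∑ j ∈ A, ∫ ω, h j (ω.eval t) ∂(P' : Measure (PathSpace k 1 E)) := by
      rw [← integral_finsetSum _ fun j _ => integrable_eval P' (h j) t]
      simp
    rw [hs1, hs2] at hle'
    have hP'0 : P' ∈ marginalSet k 0 (α 0) :=
      (map_eval_eq_of_past bot_le hpast).trans hP0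
    refine ⟨segmentLaw h0t P', ⟨P', ⟨hP'0, hC P' hpast hP'C⟩, rfl⟩, ?_⟩
    have hterm : ∀ j ∈ A, w j * Sum.elim (fun f : E →ᵇ ℝ => ∫ x, f x ∂(α t : Measure E)) c j -
          ∫ x, h j x ∂(α t : Measure E) ≤
        w j * ∫ y, (Sum.elim (fun f => finalBCF k (sub_nonneg_of_lt h0t) f) g j) y
            ∂(segmentLaw h0t P' : Measure (PathSpace k ((t : ℝ) - (0 : I)) E)) -
          ∫ ω, h j (ω.eval t) ∂(P' : Measure (PathSpace k 1 E)) := by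
      intro j _
      change _ ≤ w j * ∫ y, _ ∂(Measure.map _ _) - _
      rw [integral_map_segment h0t]
      rcases j with f | j
      · simp only [Sum.elim_inl, finalBCF_segment h0t, h, BoundedContinuousFunction.coe_smul,
          smul_eq_mul, integral_const_mul, sub_self, le_refl]
      · simp only [Sum.elim_inr, h, BoundedContinuousFunction.coe_zero, Pi.zero_apply,
          integral_zero, sub_zero]
        exact mul_le_mul_of_nonneg_left (hg j P' hpast) (hw _)
    have := Finset.sum_le_sum hterm
    rw [Finset.sum_sub_distrib, Finset.sum_sub_distrib] at this
    linarith)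
  rw [hR] at hRj
  refine ⟨P', hP', mem_marginalSet_of_forall_integral_le fun f L hL => ?_, fun j => ?_⟩
  · have := hRj (Sum.inl f)
    rw [integral_map_segment h0t] at this
    simpa only [Sum.elim_inl, finalBCF_segment h0t] using this
  · have := hRj (Sum.inr j)
    rw [integral_map_segment h0t] at this
    exact this

end

/-- A bounded Lipschitz function together with the strength of a penalization. -/
structure PenalizedTest (E : Type*) [PseudoMetricSpace E] where
  toBCF : E →ᵇ ℝ
  lip : ℝ≥0
  lipschitz : LipschitzWith lip toBCF
  strength : ℝ
  nonneg : 0 ≤ strength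

/-- The functional of a penalized test. -/
noncomputable def PenalizedTest.functional {E : Type*} [PseudoMetricSpace E] (p : PenalizedTest E)
    (k : PathKind) {T : ℝ} (hT : 0 ≤ T) (u : ℝ) : PathSpace k T E →ᵇ ℝ :=
  penalizedBCF p.toBCF p.nonneg u p.lipschitz hT

theorem MarginalsRegular.rightCont {k : PathKind} {E : Type*} [TopologicalSpace E]
    [MeasurableSpace E] [OpensMeasurableSpace E] {α : I → ProbabilityMeasure E}
    (hα : MarginalsRegular k α) (t : I) :
    ContinuousWithinAt α (Ici t) t := by
  cases k with
  | continuous => exact Continuous.continuousWithinAt hα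
  | rcll => exact hα t

open ProbabilityTheory

/-! ### From finitely many times to all times -/

section

variable {k : PathKind} {E : Type*} [MetricSpace E] [MeasurableSpace E] [BorelSpace E]
  [SecondCountableTopology E]

/-- The expectation of a bounded Lipschitz function under `μ` is at most the expectation of its
penalized suprema around time `u`. -/
def PenalizedBound (t : I) (ht : 0 < t) (u : I) (μ : ProbabilityMeasure E)
    (P : ProbabilityMeasure (PathSpace k 1 E)) : Prop :=
  ∀ p : PenalizedTest E, ∫ x, p.toBCF x ∂(μ : Measure E) ≤
    ∫ ω, p.functional k (sub_nonneg_of_lt ht) u (ω.segment 0 t) ∂(P : Measure (PathSpace k 1 E))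

/-- The time `r = u` competes in the supremum without penalty. -/
theorem PenalizedBound.of_mem_marginalSet {t : I} (ht : 0 < t) {u : I} (hut : u ≤ t)
    {μ : ProbabilityMeasure E} {P : ProbabilityMeasure (PathSpace k 1 E)}
    (hP : P ∈ marginalSet k u μ) : PenalizedBound t ht u μ P := by
  intro p
  rw [← integral_eval hP]
  refine integral_mono (integrable_eval _ _ _) (integrable_segment ht _ _) fun ω => ?_
  have h1 := le_penalizedSup p.toBCF p.nonneg u (ω.segment 0 t)
    ⟨u, u.2.1, by simpa using hut⟩
  rw [PathSpace.eval_segment, shiftTime_zero (u := u) rfl, sub_self, abs_zero, mul_zero, sub_zero] at h1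
  exact h1

/-- A longer time interval only enlarges the supremum. -/
theorem PenalizedBound.extend {t t' : I} (ht : 0 < t) (htt' : t < t') {u : I}
    {μ : ProbabilityMeasure E} {P P' : ProbabilityMeasure (PathSpace k 1 E)}
    (hPP' : ∀ F, MeasurableSet[past t] F →
      (P' : Measure (PathSpace k 1 E)) F = (P : Measure (PathSpace k 1 E)) F)
    (hP : PenalizedBound t ht u μ P) : PenalizedBound t' (ht.trans htt') u μ P' := by
  intro p
  refine (hP p).trans ?_
  rw [← integral_segment_eq_of_past ht hPP']
  exact integral_mono (integrable_segment ht _ _) (integrable_segment (ht.trans htt') _ _)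
    fun ω => penalizedSup_segment_mono p.toBCF p.nonneg u htt'.le ω

variable {α : I → ProbabilityMeasure E}
  {Γ : (s t : I) → E → Set (ProbabilityMeasure (PathSpace k ((t : ℝ) - s) E))}

/-- Laws with the right marginals at the ends of `[0, t]` and, approximately, at finitely many
intermediate times. -/
theorem exists_law_finset
    (hne : ∀ s t, s < t → ∀ x, (Γ s t x).Nonempty)
    (hstart : ∀ s t (hst : s < t), ∀ x, ∀ Q ∈ Γ s t x,
      ∀ᵐ ω ∂(Q : Measure (PathSpace k ((t : ℝ) - s) E)), ω.start (sub_nonneg_of_lt hst) = x)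
    (hG : ∀ s t : I, s < t →
      AnalyticSet {p : E × ProbabilityMeasure (PathSpace k ((t : ℝ) - s) E) | p.2 ∈ Γ s t p.1})
    (hcons : ∀ s t : I, 0 < s → s < t →
      constraintSet 0 s (Γ 0 s) ∩ constraintSet s t (Γ s t) ⊆ constraintSet 0 t (Γ 0 t))
    (hconv : ∀ t, 0 < t → Convex ℝ≥0 (ProbabilityMeasure.toMeasure ''
      segmentLaws 0 t (marginalSet k 0 (α 0) ∩ constraintSet 0 t (Γ 0 t))))
    (hcomp : ∀ t, 0 < t →
      IsCompact (segmentLaws 0 t (marginalSet k 0 (α 0) ∩ constraintSet 0 t (Γ 0 t))))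
    (hineq : ∀ s t (hst : s < t) (f : E →ᵇ ℝ),
      ∫ x, lowerExpectation (sub_nonneg_of_lt hst) (Γ s t) f x ∂(α s : Measure E) ≤
        ∫ x, f x ∂(α t : Measure E))
    (F : Finset I) : ∀ t (ht : 0 < t), (∀ u ∈ F, 0 < u ∧ u < t) →
      ∃ P ∈ marginalSet k 0 (α 0) ∩ constraintSet 0 t (Γ 0 t), P ∈ marginalSet k t (α t) ∧
        ∀ u ∈ F, PenalizedBound t ht u (α u) P := by
  induction F using Finset.induction_on_max with
  | empty =>
    intro t ht _
    -- Any law with initial marginal `α 0` serves, since everything after time `0` is replaced.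
    let P : ProbabilityMeasure (PathSpace k 1 E) := ⟨(α 0 : Measure E).map (PathSpace.const k 1),
      Measure.isProbabilityMeasure_map (PathSpace.measurable_const one_pos).aemeasurable⟩
    have hP : P ∈ marginalSet k 0 (α 0) := by
      change Measure.map _ (Measure.map _ _) = _
      rw [Measure.map_map (PathSpace.measurable_eval 0) (PathSpace.measurable_const one_pos)]
      have : (PathSpace.eval 0 ∘ PathSpace.const k 1 : E → E) = id := funext fun x => by simp
      rw [this, Measure.map_id]
    obtain ⟨P', h1, h2, -⟩ := exists_extension ht (hne 0 t ht) (hstart 0 t ht) (hG 0 t ht)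
      (hconv t ht) (hcomp t ht) (hineq 0 t ht) hP hP (fun P' _ h => h) (J := Empty)
      (fun j => j.elim) (fun j => j.elim) (fun j => j.elim)
    exact ⟨P', h1, h2, by simp⟩
  | insert a F hmax ih =>
    intro t ht hF
    obtain ⟨ha0, hat⟩ := hF a (Finset.mem_insert_self _ _)
    obtain ⟨P, ⟨hP0, hPC⟩, hPa, hPF⟩ := ih a ha0 fun u hu =>
      ⟨(hF u (Finset.mem_insert_of_mem hu)).1, hmax u hu⟩
    obtain ⟨P', h1, h2, h3⟩ := exists_extension hat (hne a t hat) (hstart a t hat) (hG a t hat)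
      (hconv t ht) (hcomp t ht) (hineq a t hat) hP0 hPa
      -- The continued law inherits the constraint on `[0, a]` through its past; consistency joins
      -- it with the one on `[a, t]`.
      (fun P' hpast h => hcons a t ha0 hat
        ⟨mem_constraintSet_of_past ha0 (hG 0 a ha0) hpast hPC, h⟩)
      (J := {u // u ∈ insert a F} × PenalizedTest E)
      (fun j => j.2.functional k (sub_nonneg_of_lt ht) j.1)
      (fun j => ∫ x, j.2.toBCF x ∂(α j.1 : Measure E))
      (by
        rintro ⟨⟨u, hu⟩, p⟩ P' hpast
        rcases Finset.mem_insert.1 hu with rfl | hu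
        · exact PenalizedBound.of_mem_marginalSet ht hat.le
            ((map_eval_eq_of_past le_rfl hpast).trans hPa) p
        · exact (hPF u hu).extend ha0 hat hpast p)
    exact ⟨P', h1, h2, fun u hu p => h3 (⟨u, hu⟩, p)⟩

/-- If the penalized bounds hold at all times after `t`, and the marginals are right continuous at
`t`, then the marginal at time `t` is the right one. -/
theorem mem_marginalSet_of_penalizedBound {P : ProbabilityMeasure (PathSpace k 1 E)} {t : I}
    (ht : t < 1) (hα : ContinuousWithinAt α (Ici t) t)
    (hP : ∀ u, t < u → u < 1 → PenalizedBound 1 zero_lt_one u (α u) P) :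
    P ∈ marginalSet k t (α t) := by
  have ht1 : (t : ℝ) < 1 := ht
  have h01 : (0 : I) < 1 := zero_lt_one
  refine mem_marginalSet_of_forall_integral_le fun f L hL => ?_
  -- The denominator `n + 2` keeps the approximating times strictly between `t` and `1`.
  have hpos : ∀ n : ℕ, 0 < (1 - (t : ℝ)) / (n + 2) := fun n =>
    div_pos (sub_pos.2 ht1) (by positivity)
  have hlt : ∀ n : ℕ, (1 - (t : ℝ)) / (n + 2) < 1 - t := fun n =>
    div_lt_self (sub_pos.2 ht1) (by have : (0 : ℝ) ≤ n := n.cast_nonneg; linarith)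
  let u : ℕ → I := fun n => ⟨t + (1 - t) / (n + 2), by
    have := hpos n; have := hlt n; have := t.2.1; constructor <;> linarith⟩
  have htu : ∀ n, t < u n := fun n =>
    show (t : ℝ) < t + (1 - t) / (n + 2) by linarith [hpos n]
  have hu1 : ∀ n, u n < 1 := fun n =>
    show (t : ℝ) + (1 - t) / (n + 2) < 1 by linarith [hlt n]
  have hlim0 : Tendsto (fun n : ℕ => (t : ℝ) + (1 - t) / (n + 2)) atTop (𝓝 t) := by
    have h1 : Tendsto (fun n : ℕ => (n : ℝ) + 2) atTop atTop :=
      tendsto_atTop_add_const_right _ _ tendsto_natCast_atTop_atTop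
    simpa using (tendsto_const_nhds (x := (t : ℝ))).add (h1.const_div_atTop (1 - (t : ℝ)))
  have hlim : Tendsto u atTop (𝓝 t) := tendsto_subtype_rng.2 hlim0
  have hαlim : Tendsto (fun n => α (u n)) atTop (𝓝 (α t)) :=
    hα.tendsto.comp (tendsto_nhdsWithin_iff.2 ⟨hlim, .of_forall fun n => (htu n).le⟩)
  have hm : ∀ n, 0 ≤ 2 * ‖f‖ / ((u n : ℝ) - t) := fun n =>
    div_nonneg (by positivity) (sub_nonneg.2 (htu n).le)
  let t' : Icc (0 : ℝ) ((1 : I) - (0 : I) : ℝ) := ⟨t, t.2.1, by simpa using t.2.2⟩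
  let u' : ℕ → Icc (0 : ℝ) ((1 : I) - (0 : I) : ℝ) := fun n =>
    ⟨u n, (u n).2.1, by simpa using (u n).2.2⟩
  let p : ℕ → PenalizedTest E := fun n => ⟨f, L, hL, 2 * ‖f‖ / ((u n : ℝ) - t), hm n⟩
  have hptw : ∀ ω : PathSpace k 1 E, Tendsto (fun n =>
      (p n).functional k (sub_nonneg_of_lt h01) (u n) (ω.segment 0 1)) atTop (𝓝 (f (ω.eval t))) := by
    intro ω
    have := tendsto_penalizedSup f (ω.segment 0 1) (t := t') (u := u') (fun n => htu n)
      (tendsto_subtype_rng.2 hlim0)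
    rwa [PathSpace.eval_segment, shiftTime_zero (u := t) rfl] at this
  have hint : Tendsto (fun n => ∫ ω, (p n).functional k (sub_nonneg_of_lt h01) (u n)
      (ω.segment 0 1) ∂(P : Measure (PathSpace k 1 E))) atTop
      (𝓝 (∫ ω, f (ω.eval t) ∂(P : Measure (PathSpace k 1 E)))) := by
    refine tendsto_integral_of_dominated_convergence (fun _ => ‖f‖)
      (fun n => (integrable_segment h01 P _).aestronglyMeasurable) (integrable_const _)
      (fun n => ae_of_all _ fun ω => ?_) (ae_of_all _ hptw)
    rw [Real.norm_eq_abs, abs_le]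
    refine ⟨?_, penalizedSup_le_norm f (hm n) (u n) (sub_nonneg_of_lt h01) _⟩
    have h1 := le_penalizedSup f (hm n) (u n) (ω.segment 0 1) (u' n)
    simp only [u', sub_self, abs_zero, mul_zero, sub_zero] at h1
    exact (abs_le.1 (f.norm_coe_le_norm _)).1.trans h1
  exact le_of_tendsto_of_tendsto'
    (ProbabilityMeasure.tendsto_iff_forall_integral_tendsto.1 hαlim f) hint
    fun n => hP (u n) (htu n) (hu1 n) (p n)

/-- Existence of an admissible law with the prescribed marginals. -/
theorem exists_law (hα : MarginalsRegular k α)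
    (hcomp : IsCompact (segmentLaws 0 1 (marginalSet k 0 (α 0) ∩ constraintSet 0 1 (Γ 0 1))))
    (hconv : Convex ℝ≥0 (ProbabilityMeasure.toMeasure ''
      segmentLaws 0 1 (marginalSet k 0 (α 0) ∩ constraintSet 0 1 (Γ 0 1))))
    (hfin : ∀ F : Finset I, (∀ u ∈ F, 0 < u ∧ u < 1) →
      ∃ P ∈ marginalSet k 0 (α 0) ∩ constraintSet 0 1 (Γ 0 1), P ∈ marginalSet k 1 (α 1) ∧
        ∀ u ∈ F, PenalizedBound 1 zero_lt_one u (α u) P) :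
    ∃ P ∈ constraintSet 0 1 (Γ 0 1), ∀ t, P ∈ marginalSet k t (α t) := by
  classical
  have h01 : (0 : I) < 1 := zero_lt_one
  obtain ⟨R, ⟨P, hP, hR⟩, hRj⟩ := exists_forall_le_integral hcomp hconv
    (J := (E →ᵇ ℝ) ⊕ ({u : I // 0 < u ∧ u < 1} × PenalizedTest E))
    (Sum.elim (fun f => finalBCF k (sub_nonneg_of_lt h01) f)
      fun j => j.2.functional k (sub_nonneg_of_lt h01) j.1)
    (Sum.elim (fun f => ∫ x, f x ∂(α 1 : Measure E))
      fun j => ∫ x, j.2.toBCF x ∂(α j.1 : Measure E)) (by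
    intro A w hw ε hε
    -- A single law meets all of the finitely many bounds involved, so every weighted combination
    -- holds termwise.
    obtain ⟨P, hP, hP1, hPF⟩ := hfin (A.biUnion fun j => Sum.elim (fun _ => ∅)
      (fun j => {(j.1 : I)}) j) (by
        intro u hu
        obtain ⟨j, -, hj⟩ := Finset.mem_biUnion.1 hu
        rcases j with f | j
        · simp at hj
        · simp only [Sum.elim_inr, Finset.mem_singleton] at hj
          exact hj ▸ j.1.2)
    refine ⟨segmentLaw h01 P, ⟨P, hP, rfl⟩, (sub_le_self _ hε.le).trans
      (Finset.sum_le_sum fun j hj => mul_le_mul_of_nonneg_left ?_ (hw j))⟩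
    change _ ≤ ∫ y, _ ∂(Measure.map _ _)
    rw [integral_map_segment h01]
    rcases j with f | j
    · simp only [Sum.elim_inl, finalBCF_segment h01]
      exact (integral_eval hP1 f).ge
    · exact hPF j.1 (Finset.mem_biUnion.2 ⟨_, hj, by simp⟩) j.2)
  rw [hR] at hRj
  refine ⟨P, hP.2, fun t => ?_⟩
  -- Time `1` has no times to its right, but evaluation there is continuous, so its marginal is
  -- imposed exactly.
  rcases eq_or_lt_of_le (show t ≤ 1 from le_top) with rfl | ht
  · refine mem_marginalSet_of_forall_integral_le fun f L hL => ?_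
    have := hRj (Sum.inl f)
    rw [integral_map_segment h01] at this
    simpa only [Sum.elim_inl, finalBCF_segment h01] using this
  · refine mem_marginalSet_of_penalizedBound ht (hα.rightCont t) fun u htu hu1 p => ?_
    have := hRj (Sum.inr (⟨u, lt_of_le_of_lt bot_le htu, hu1⟩, p))
    rw [integral_map_segment h01] at this
    exact this

/-- The necessity of the inequality between the marginals. -/
theorem integral_lowerExpectation_le {s t : I} (hst : s < t)
    {G : E → Set (ProbabilityMeasure (PathSpace k ((t : ℝ) - s) E))}
    (hne : ∀ x, (G x).Nonempty)
    (hG : AnalyticSet {p : E × ProbabilityMeasure (PathSpace k ((t : ℝ) - s) E) | p.2 ∈ G p.1})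
    {P : ProbabilityMeasure (PathSpace k 1 E)} (hP : P ∈ constraintSet s t G)
    {μ ν : ProbabilityMeasure E} (hs : P ∈ marginalSet k s μ) (ht : P ∈ marginalSet k t ν)
    (f : E →ᵇ ℝ) : ∫ x, lowerExpectation (sub_nonneg_of_lt hst) G f x ∂(μ : Measure E) ≤
      ∫ x, f x ∂(ν : Measure E) := by
  obtain ⟨κ, hκ, hae⟩ := hP
  have hT := sub_nonneg_of_lt hst
  have hs' : (P : Measure (PathSpace k 1 E)).map (PathSpace.eval s) = μ := hs
  have hκm : Measurable fun ω => (κ ω : Measure (PathSpace k ((t : ℝ) - s) E)) :=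
    Measure.measurable_of_measurable_coe _ fun B hB =>
      (hκ.measurable B hB).mono (past_le _) le_rfl
  have hbind : (P : Measure (PathSpace k 1 E)).map (PathSpace.segment s t) =
      (P : Measure (PathSpace k 1 E)).bind fun ω => (κ ω : Measure _) := by
    ext B hB
    have := hκ.setLIntegral_eq B hB univ (@MeasurableSet.univ _ (past s))
    rw [Measure.restrict_univ, univ_inter] at this
    rw [Measure.bind_apply hB hκm.aemeasurable, this,
      Measure.map_apply (PathSpace.measurable_segment hst) hB]
  have hκf : ∫ ω, f (ω.eval t) ∂(P : Measure (PathSpace k 1 E)) =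
      ∫ ω, ∫ η, finalBCF k hT f η ∂(κ ω : Measure (PathSpace k ((t : ℝ) - s) E))
        ∂(P : Measure (PathSpace k 1 E)) := by
    let K : ProbabilityTheory.Kernel (PathSpace k 1 E) (PathSpace k ((t : ℝ) - s) E) :=
      ⟨fun ω => κ ω, hκm⟩
    have : ProbabilityTheory.IsMarkovKernel K := ⟨fun ω => inferInstanceAs
      (IsProbabilityMeasure (κ ω : Measure (PathSpace k ((t : ℝ) - s) E)))⟩
    have h1 := integral_map_segment hst (P : Measure (PathSpace k 1 E)) (finalBCF k hT f)
    simp only [finalBCF_segment hst] at h1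
    rw [← h1, hbind]
    have hsnd : (P : Measure (PathSpace k 1 E)).bind (fun ω => (κ ω : Measure _)) =
        ((P : Measure (PathSpace k 1 E)) ⊗ₘ K).map Prod.snd := (Measure.snd_compProd _ K).symm
    rw [hsnd, integral_map measurable_snd.aemeasurable
      (finalBCF k hT f).continuous.measurable.aestronglyMeasurable]
    exact Measure.integral_compProd (Integrable.of_bound
      ((finalBCF k hT f).continuous.measurable.comp measurable_snd).aestronglyMeasurable
      ‖finalBCF k hT f‖ (ae_of_all _ fun _ => (finalBCF k hT f).norm_coe_le_norm _))
  have hint := integrable_lowerExpectation hT hne hG f (μ : Measure E)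
  rw [← integral_eval ht f, hκf, ← hs', integral_map (PathSpace.measurable_eval s).aemeasurable
    (hs' ▸ hint.aestronglyMeasurable)]
  refine integral_mono_ae ?_ ?_ ?_
  · rw [← hs'] at hint
    exact hint.comp_measurable (PathSpace.measurable_eval s)
  · refine Integrable.of_bound (measurable_integral_law hκm _).aestronglyMeasurable
      ‖finalBCF k hT f‖ (ae_of_all _ fun ω => ?_)
    have := norm_integral_le_of_norm_le_const
      (μ := (κ ω : Measure (PathSpace k ((t : ℝ) - s) E)))
      (ae_of_all _ fun η : PathSpace k ((t : ℝ) - s) E => (finalBCF k hT f).norm_coe_le_norm η)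
    simpa using this
  · filter_upwards [hae] with ω hω
    refine ciInf_le ((bddBelow_integral_final (k := k) hT f).mono ?_) (⟨κ ω, hω⟩ : G (ω.eval s))
    rintro _ ⟨Q, rfl⟩
    exact ⟨Q, rfl⟩

end

end ConstrainedPeacock

theorem theorem3 {d : ℕ} (X : Set (EuclideanSpace ℝ (Fin d)))
    (hX_closed : IsClosed X) (hX_conn : IsConnected X)
    (k : PathKind)
    (α : I → ProbabilityMeasure X) (hα : MarginalsRegular k α)
    (Γ : (s t : I) → X → Set (ProbabilityMeasure (PathSpace k ((t : ℝ) - s) X)))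
    (hΓ_nonempty : ∀ s t, s < t → ∀ x, (Γ s t x).Nonempty)
    (hΓ_start : ∀ s t (hst : s < t), ∀ x, ∀ Q ∈ Γ s t x,
      ∀ᵐ ω ∂(Q : Measure (PathSpace k ((t : ℝ) - s) X)), ω.start (sub_nonneg_of_lt hst) = x)
    (hΓ_analytic : ∀ s t : I, s < t →
      AnalyticSet {p : X × ProbabilityMeasure (PathSpace k ((t : ℝ) - s) X) | p.2 ∈ Γ s t p.1})
    (hΓ_consistent : ∀ s t s' t', s < t → s' < t' → (Icc s t ∩ Icc s' t').Nonempty →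
      constraintSet s t (Γ s t) ∩ constraintSet s' t' (Γ s' t') =
        constraintSet (s ⊓ s') (t ⊔ t') (Γ (s ⊓ s') (t ⊔ t')))
    (h_convex : ∀ s t, s < t → Convex ℝ≥0
      (ProbabilityMeasure.toMeasure ''
        segmentLaws s t (marginalSet k s (α s) ∩ constraintSet s t (Γ s t))))
    (h_compact : ∀ s t, s < t →
      IsCompact (segmentLaws s t (marginalSet k s (α s) ∩ constraintSet s t (Γ s t)))) :
    ((⋂ r, marginalSet k r (α r)) ∩
        ⋂ (s) (t) (_ : s < t), constraintSet s t (Γ s t)).Nonempty ↔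
      ∀ s t (hst : s < t) (f : X →ᵇ ℝ),
        ∫ x, lowerExpectation (sub_nonneg_of_lt hst) (Γ s t) f x ∂(α s : Measure X) ≤
          ∫ x, f x ∂(α t : Measure X) := by
  -- The type of `Γ s t` depends on `s` and `t`, so equal times are exchanged at the level of
  -- constraint sets, which all live in one type.
  have hcongr : ∀ a b a' b' : I, a = a' → b = b' →
      constraintSet a b (Γ a b) = constraintSet a' b' (Γ a' b') := by
    rintro a b _ _ rfl rfl; rfl
  have hcons : ∀ s t : I, 0 < s → s < t →
      constraintSet 0 s (Γ 0 s) ∩ constraintSet s t (Γ s t) ⊆ constraintSet 0 t (Γ 0 t) := by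
    intro s t hs hst
    rw [hΓ_consistent 0 s s t hs hst ⟨s, ⟨bot_le, le_rfl⟩, ⟨le_rfl, hst.le⟩⟩,
      hcongr (0 ⊓ s) (s ⊔ t) 0 t (inf_eq_left.2 bot_le) (sup_eq_right.2 hst.le)]
  have hsub : ∀ s t : I, s < t →
      constraintSet 0 1 (Γ 0 1) ⊆ constraintSet s t (Γ s t) := by
    intro s t hst
    have h := hΓ_consistent 0 1 s t zero_lt_one hst ⟨s, ⟨bot_le, le_top⟩, ⟨le_rfl, hst.le⟩⟩
    rw [hcongr (0 ⊓ s) (1 ⊔ t) 0 1 (inf_eq_left.2 bot_le) (sup_eq_left.2 le_top)] at h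
    exact inter_eq_left.1 h
  constructor
  · rintro ⟨P, hPA, hPC⟩ s t hst f
    rw [mem_iInter] at hPA
    exact integral_lowerExpectation_le hst (hΓ_nonempty s t hst) (hΓ_analytic s t hst)
      (mem_iInter₂.1 (mem_iInter.1 hPC s) t hst) (hPA s) (hPA t) f
  · intro hineq
    obtain ⟨P, hPC, hPA⟩ := exists_law hα (h_compact 0 1 zero_lt_one) (h_convex 0 1 zero_lt_one)
      fun F => exists_law_finset hΓ_nonempty hΓ_start hΓ_analytic hcons
        (fun t ht => h_convex 0 t ht) (fun t ht => h_compact 0 t ht) hineq F 1 zero_lt_one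
    exact ⟨P, mem_iInter.2 hPA,
      mem_iInter.2 fun s => mem_iInter₂.2 fun t hst => hsub s t hst hPC⟩
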